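/- Let $\frac12<H_1<H_2<1$. For $0<s<t$ put $$K_{H_1,H_2}(t,s)=\beta_{H_2}\,s^{1/2-H_2}\int_s^t (t-u)^{1/2-H_1}u^{H_2-H_1}(u-s)^{H_2-3/2}\,du,\qquad \beta_H=\Big(\frac{H(2H-1)}{B(H-\frac12,\,2-2H)}\Big)^{1/2},$$ where $B$ is the beta function, and for $s,u\in(0,1]$, $s\ne u$, let $$k(s,u)=\int_0^{s\wedge u}\partial_sK_{H_1,H_2}(s,v)\,\partial_uK_{H_1,H_2}(u,v)\,dv,\qquad k_1(s,u)=s^{H_1-1/2}u^{H_1-1/2}k(s,u),$$ $$(Kf)(u)=\int_0^1 f(s)\,k_1(s,u)\,ds .$$ Then for every constant $C>0$ the integral equation of the first kind $$u^{1/2-H_1}=C\,(Kh)(u),\qquad u\in(0,1],$$ has a unique solution (up to equality almost everywhere on $(0,1]$), namely $$h_0(v)=C_6\,v^{1/2-H_1}\Big(I_{1-}^{H_1-1/2}\big(x\mapsto x^{H_1-H_2}(1-x)^{1/2-H_2}\big)\Big)(v),$$ $$C_6=\frac{\Gamma(2-2H_1)}{C\,H_2(2H_2-1)\,\Gamma(\frac32-H_1)^3\,\Gamma(H_2-\frac12)\,\Gamma(\frac32-H_2)},$$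 where $(I_{1-}^{\alpha}f)(x)=\frac1{\Gamma(\alpha)}\int_x^1 f(t)(t-x)^{\alpha-1}\,dt$ is the right-sided Riemann–Liouville fractional integral. More precisely: (i) $h_0\in L^2(0,1]$, and for every $u\in(0,1]$ the integral $(Kh_0)(u)$ converges absolutely and the equation holds at $u$; (ii) if $h$ is a measurable function on $(0,1]$ such that for almost every $u\in(0,1]$ the integral $(Kh)(u)$ converges absolutely and the equation holds at $u$, then $h=h_0$ almost everywhere on $(0,1]$. -/

import Mathlib

open MeasureTheory Set

noncomputable section

namespace MixedFBM

/-- The normalising constant `β_H = (H (2H - 1) / B(H - 1/2, 2 - 2H)) ^ (1/2)` of the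
Molchan-Golosov kernel of fractional Brownian motion, `B` being Euler's beta function. -/
def betaH (H : ℝ) : ℝ :=
  Real.sqrt (H * (2 * H - 1) / ProbabilityTheory.beta (H - 1 / 2) (2 - 2 * H))

/-- The Volterra kernel
`K_{H₁,H₂}(t,s) = β_{H₂} s^{1/2-H₂} ∫_s^t (t-u)^{1/2-H₁} u^{H₂-H₁} (u-s)^{H₂-3/2} du`
(meaningful for `0 < s < t`). -/
def volterraKernel (H₁ H₂ t s : ℝ) : ℝ :=
  betaH H₂ * s ^ (1 / 2 - H₂) *
    ∫ u in s..t, (t - u) ^ (1 / 2 - H₁) * u ^ (H₂ - H₁) * (u - s) ^ (H₂ - 3 / 2)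

/-- The partial derivative of `K_{H₁,H₂}(t,s)` in its first argument `t`. -/
def volterraKernelDeriv (H₁ H₂ t s : ℝ) : ℝ :=
  deriv (fun x => volterraKernel H₁ H₂ x s) t

/-- `k(s,u) = ∫_0^{s ∧ u} ∂_s K_{H₁,H₂}(s,v) ∂_u K_{H₁,H₂}(u,v) dv`. -/
def kernelk (H₁ H₂ s u : ℝ) : ℝ :=
  ∫ v in (0 : ℝ)..(min s u), volterraKernelDeriv H₁ H₂ s v * volterraKernelDeriv H₁ H₂ u v

/-- `k₁(s,u) = s^{H₁-1/2} u^{H₁-1/2} k(s,u)`. -/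
def kernelk₁ (H₁ H₂ s u : ℝ) : ℝ :=
  s ^ (H₁ - 1 / 2) * u ^ (H₁ - 1 / 2) * kernelk H₁ H₂ s u

/-- The integral operator `(K f)(u) = ∫_0^1 f(s) k₁(s,u) ds`. -/
def opK (H₁ H₂ : ℝ) (f : ℝ → ℝ) (u : ℝ) : ℝ :=
  ∫ s in (0 : ℝ)..1, f s * kernelk₁ H₁ H₂ s u

/-- The right-sided Riemann-Liouville fractional integral
`(I_{b-}^α f)(x) = Γ(α)⁻¹ ∫_x^b f(t) (t-x)^{α-1} dt`. -/
def fracIntegralRight (α b : ℝ) (f : ℝ → ℝ) (x : ℝ) : ℝ :=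
  1 / Real.Gamma α * ∫ t in x..b, f t * (t - x) ^ (α - 1)

/-- The constant in front of the explicit solution of `u^{1/2-H₁} = C (K h)(u)`. -/
def solConst (H₁ H₂ C : ℝ) : ℝ :=
  Real.Gamma (2 - 2 * H₁) /
    (C * H₂ * (2 * H₂ - 1) * Real.Gamma (3 / 2 - H₁) ^ 3 *
      Real.Gamma (H₂ - 1 / 2) * Real.Gamma (3 / 2 - H₂))

/-- The explicit solution
`h(v) = C₆ v^{1/2-H₁} (I_{1-}^{H₁-1/2} (x ↦ x^{H₁-H₂} (1-x)^{1/2-H₂}))(v)`. -/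
def solution (H₁ H₂ C v : ℝ) : ℝ :=
  solConst H₁ H₂ C * v ^ (1 / 2 - H₁) *
    fracIntegralRight (H₁ - 1 / 2) 1 (fun x => x ^ (H₁ - H₂) * (1 - x) ^ (1 / 2 - H₂)) v

end MixedFBM

end

open scoped ENNReal

namespace MixedFBM

/-! Put `a = H₁ - 1/2` and `b = H₂ - 1/2`, so that `0 < a < b < 1/2`, and let `T` be the Volterra
operator `(T f)(u) = ∫ kerDeriv u v * f v dv`, with adjoint `(T* f)(v) = ∫ kerDeriv s v * f s ds`.
Up to the factor `betaH H₂ ^ 2`, the operator `K` is `M T T* M`, where `M` is multiplication by `s ^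
a`. With `g = M h` the equation becomes `T T* g = const * u ^ (-2a)`, to be solved for `g` and then
shown to have only that solution.

Write `I^α` for the left-sided fractional integral, up to constants. The primitive of `T f` is
`I^{1-a}(u^{b-a} I^b(v^{-b} f))`. Hence `T` is a derivative of weighted Abel operators, and
everything reduces to composing these by beta integrals, complementary exponents giving a plain
primitive.

Existence: `T` maps `v^{-b}` to a multiple of `u^{-2a}` by homogeneity
(`lintegral_kerDeriv_mul_pw_neg`, constant in `lintegral_kerDeriv_one`), and `T*` maps `solAux` to a
multiple of `v^{-b}` on `(0,1)` (`lintegral_kerDeriv_mul_solAux`).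

Uniqueness: `T` is injective by undoing two Abel operators. For `T*`, pairing `T* f` with the
functions `invKer b (b - a) y` yields, for every `y > 0`, the integral over `x > y` of `x^{b-a-1}`
times a right-sided Abel transform of `f`, which again determines `f`.

All of this takes place for functions with values in `ℝ≥0∞`, where Tonelli needs no integrability. A
signed solution is handled by moving its negative part to the other side: `h⁺` and `h⁻ + h₀` have
the same finite image under `K`, hence coincide. -/

/-! ### Positive-part powers with values in `ℝ≥0∞`. -/

/-- The positive-part power `x₊^α`, with values in `ℝ≥0∞`; it vanishes for `x ≤ 0`. -/
noncomputable def pw (α x : ℝ) : ℝ≥0∞ := if 0 < x then ENNReal.ofReal (x ^ α) else 0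

lemma pw_of_pos {α x : ℝ} (hx : 0 < x) : pw α x = ENNReal.ofReal (x ^ α) := if_pos hx

lemma pw_of_nonpos {α x : ℝ} (hx : x ≤ 0) : pw α x = 0 := if_neg hx.not_gt

@[fun_prop]
lemma measurable_pw (α : ℝ) : Measurable (pw α) :=
  Measurable.ite measurableSet_Ioi (by fun_prop) measurable_const

lemma pw_ne_top (α x : ℝ) : pw α x ≠ ∞ := by
  unfold pw; split_ifs <;> simp

lemma pw_ne_zero {α x : ℝ} (hx : 0 < x) : pw α x ≠ 0 := by
  rw [pw_of_pos hx]; simpa using Real.rpow_pos_of_pos hx α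

lemma pw_zero_of_pos {x : ℝ} (hx : 0 < x) : pw 0 x = 1 := by simp [pw_of_pos hx]

lemma pw_one_right (α : ℝ) : pw α 1 = 1 := by simp [pw]

lemma toReal_pw {α x : ℝ} (hx : 0 < x) : (pw α x).toReal = x ^ α := by
  rw [pw_of_pos hx, ENNReal.toReal_ofReal (Real.rpow_nonneg hx.le _)]

lemma pw_mul {α x y : ℝ} (hx : 0 < x) : pw α (x * y) = pw α x * pw α y := by
  rcases le_or_gt y 0 with hy | hy
  · rw [pw_of_nonpos hy, pw_of_nonpos (mul_nonpos_of_nonneg_of_nonpos hx.le hy), mul_zero]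
  · rw [pw_of_pos hx, pw_of_pos hy, pw_of_pos (mul_pos hx hy), Real.mul_rpow hx.le hy.le,
      ENNReal.ofReal_mul (Real.rpow_nonneg hx.le _)]

lemma pw_add (α β x : ℝ) : pw (α + β) x = pw α x * pw β x := by
  rcases le_or_gt x 0 with hx | hx
  · simp [pw_of_nonpos hx]
  · rw [pw_of_pos hx, pw_of_pos hx, pw_of_pos hx, Real.rpow_add hx,
      ENNReal.ofReal_mul (Real.rpow_nonneg hx.le _)]

lemma pw_neg_mul_self {α x : ℝ} (hx : 0 < x) : pw (-α) x * pw α x = 1 := by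
  rw [← pw_add, neg_add_cancel, pw_zero_of_pos hx]

lemma pw_le_pw {α x y : ℝ} (hα : 0 ≤ α) (hxy : x ≤ y) : pw α x ≤ pw α y := by
  rcases le_or_gt x 0 with hx | hx
  · simp [pw_of_nonpos hx]
  · rw [pw_of_pos hx, pw_of_pos (hx.trans_le hxy)]
    exact ENNReal.ofReal_le_ofReal (Real.rpow_le_rpow hx.le hxy hα)

lemma one_le_pw {α x : ℝ} (hα : α ≤ 0) (hx : 0 < x) (hx1 : x ≤ 1) : 1 ≤ pw α x := by
  rw [pw_of_pos hx, ← ENNReal.ofReal_one]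
  exact ENNReal.ofReal_le_ofReal (Real.one_le_rpow_of_pos_of_le_one_of_nonpos hx hx1 hα)

lemma pw_le_pw_of_nonpos {α x y : ℝ} (hα : α ≤ 0) (hx : 0 < x) (hxy : x ≤ y) :
    pw α y ≤ pw α x := by
  rw [pw_of_pos hx, pw_of_pos (hx.trans_le hxy)]
  exact ENNReal.ofReal_le_ofReal (Real.rpow_le_rpow_of_nonpos hx hxy hα)

lemma pw_zero_le_one (x : ℝ) : pw 0 x ≤ 1 := by
  rcases le_or_gt x 0 with hx | hx
  · simp [pw_of_nonpos hx]
  · simp [pw_zero_of_pos hx]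

/-! ### Changes of variables and beta integrals. -/

lemma lintegral_affine (f : ℝ → ℝ≥0∞) (s : ℝ) {l : ℝ} (hl : 0 < l) :
    ∫⁻ u, f u = ENNReal.ofReal l * ∫⁻ x, f (s + l * x) := by
  have h1 : ∫⁻ u, f u = ∫⁻ u, f (s + u) := (lintegral_add_left_eq_self f s).symm
  have h2 := Real.smul_map_volume_mul_left hl.ne'
  rw [h1]
  conv_lhs => rw [← h2]
  rw [lintegral_smul_measure, abs_of_pos hl, smul_eq_mul]
  congr 1
  exact lintegral_map_equiv (fun u => f (s + u)) (Homeomorph.mulLeft₀ l hl.ne').toMeasurableEquiv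

lemma lintegral_comp_neg (f : ℝ → ℝ≥0∞) : ∫⁻ x, f (-x) = ∫⁻ x, f x :=
  (Measure.measurePreserving_neg (volume : Measure ℝ)).lintegral_comp_emb
    (MeasurableEquiv.neg ℝ).measurableEmbedding f

/-- Euler's beta function with values in `ℝ≥0∞`. -/
noncomputable def ebeta (α β : ℝ) : ℝ≥0∞ := ENNReal.ofReal (ProbabilityTheory.beta α β)

lemma ebeta_ne_top (α β : ℝ) : ebeta α β ≠ ∞ := ENNReal.ofReal_ne_top

lemma ebeta_ne_zero {α β : ℝ} (hα : 0 < α) (hβ : 0 < β) : ebeta α β ≠ 0 := by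
  simpa [ebeta] using ProbabilityTheory.beta_pos hα hβ

lemma lintegral_pw_mul_pw_one {α β : ℝ} (hα : 0 < α) (hβ : 0 < β) :
    ∫⁻ x, pw (α - 1) x * pw (β - 1) (1 - x) = ebeta α β := by
  have hB := ProbabilityTheory.beta_pos hα hβ
  have : ∀ x, pw (α - 1) x * pw (β - 1) (1 - x) =
      ebeta α β * ProbabilityTheory.betaPDF α β x := by
    intro x
    rcases le_or_gt x 0 with hx | hx
    · rw [pw_of_nonpos hx, ProbabilityTheory.betaPDF_eq_zero_of_nonpos hx]; simp
    rcases le_or_gt 1 x with hx1 | hx1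
    · rw [pw_of_nonpos (x := 1 - x) (by linarith),
        ProbabilityTheory.betaPDF_eq_zero_of_one_le hx1]; simp
    · rw [pw_of_pos hx, pw_of_pos (by linarith), ProbabilityTheory.betaPDF_of_pos_lt_one hx hx1,
        ebeta, ← ENNReal.ofReal_mul (Real.rpow_nonneg hx.le _), ← ENNReal.ofReal_mul hB.le]
      congr 1
      field_simp
  simp_rw [this]
  rw [lintegral_const_mul' _ _ (ebeta_ne_top _ _),
    ProbabilityTheory.lintegral_betaPDF_eq_one hα hβ, mul_one]

/-- The beta integral over `(x, y)`. -/
lemma lintegral_pw_mul_pw {α β : ℝ} (hα : 0 < α) (hβ : 0 < β) (x y : ℝ) :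
    ∫⁻ u, pw (α - 1) (u - x) * pw (β - 1) (y - u) = ebeta α β * pw (α + β - 1) (y - x) := by
  rcases le_or_gt y x with h | h
  · have : ∀ u, pw (α - 1) (u - x) * pw (β - 1) (y - u) = 0 := by
      intro u
      rcases le_or_gt u x with hu | hu
      · rw [pw_of_nonpos (by linarith), zero_mul]
      · rw [pw_of_nonpos (x := y - u) (by linarith), mul_zero]
    simp [this, pw_of_nonpos (sub_nonpos.2 h)]
  · have hl : 0 < y - x := sub_pos.2 h
    rw [lintegral_affine _ x hl]
    have : ∀ t, pw (α - 1) (x + (y - x) * t - x) * pw (β - 1) (y - (x + (y - x) * t)) =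
        (pw (α - 1) (y - x) * pw (β - 1) (y - x)) * (pw (α - 1) t * pw (β - 1) (1 - t)) := by
      intro t
      rw [show x + (y - x) * t - x = (y - x) * t by ring,
        show y - (x + (y - x) * t) = (y - x) * (1 - t) by ring, pw_mul hl, pw_mul hl]
      ring
    simp_rw [this]
    rw [lintegral_const_mul' _ _ (ENNReal.mul_ne_top (pw_ne_top _ _) (pw_ne_top _ _)),
      lintegral_pw_mul_pw_one hα hβ, show α + β - 1 = 1 + ((α - 1) + (β - 1)) by ring, pw_add 1,
      pw_add (α - 1)]
    rw [pw_of_pos hl (α := 1), Real.rpow_one]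
    ring

/-! ### Uniqueness for primitives and for Abel's equation. -/

/-- Functions with the same finite primitives `∫_{x < t} f` agree almost everywhere. -/
lemma ae_eq_of_primitive_eq {f g : ℝ → ℝ≥0∞} (hf : Measurable f) (hg : Measurable g) {R : ℝ}
    (hfin : ∀ t < R, ∫⁻ x, f x * pw 0 (t - x) ≠ ∞)
    (heq : ∀ t < R, ∫⁻ x, f x * pw 0 (t - x) = ∫⁻ x, g x * pw 0 (t - x)) :
    ∀ᵐ x, x < R → f x = g x := by
  have key : ∀ (f : ℝ → ℝ≥0∞) (t : ℝ), ∫⁻ x, f x * pw 0 (t - x) = ∫⁻ x in Iio t, f x := by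
    intro f t
    rw [← lintegral_indicator measurableSet_Iio]
    congr 1 with x
    by_cases hx : x < t
    · rw [indicator_of_mem (by exact hx), pw_zero_of_pos (sub_pos.2 hx), mul_one]
    · rw [indicator_of_notMem (by exact hx), pw_of_nonpos (by linarith), mul_zero]
  simp_rw [key] at hfin heq
  -- Primitives are assumed finite only strictly below `R`. On `Iio T` the two functions are
  -- densities of finite measures, which agree as soon as they agree on half-lines; then `T` runs
  -- through `R - 1/(n+1)`.
  have main : ∀ T < R, ∀ᵐ x, x < T → f x = g x := by
    intro T hT
    refine (ae_restrict_iff' measurableSet_Iio).1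
      (?_ : f =ᵐ[volume.restrict (Iio T)] g)
    refine (withDensity_eq_iff hf.aemeasurable hg.aemeasurable (hfin T hT)).1 ?_
    have : IsFiniteMeasure ((volume.restrict (Iio T)).withDensity f) :=
      isFiniteMeasure_withDensity (hfin T hT)
    have : IsFiniteMeasure ((volume.restrict (Iio T)).withDensity g) :=
      isFiniteMeasure_withDensity (heq T hT ▸ hfin T hT)
    refine Measure.ext_of_Iic _ _ fun t => ?_
    rw [withDensity_apply _ measurableSet_Iic, withDensity_apply _ measurableSet_Iic,
      Measure.restrict_restrict measurableSet_Iic]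
    rcases lt_or_ge t T with h | h
    · have : Iic t ∩ Iio T = Iic t := inter_eq_left.2 fun x hx => lt_of_le_of_lt hx h
      rw [this, ← restrict_Iio_eq_restrict_Iic, heq t (h.trans hT)]
    · have : Iic t ∩ Iio T = Iio T := inter_eq_right.2 fun x hx => (le_of_lt hx).trans h
      rw [this, heq T hT]
  have hall : ∀ᵐ x, ∀ n : ℕ, x < R - 1 / ((n : ℝ) + 1) → f x = g x :=
    ae_all_iff.2 fun n => main _ (by have : (0 : ℝ) < 1 / ((n : ℝ) + 1) := by positivity
                                     linarith)
  filter_upwards [hall] with x hx hxR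
  obtain ⟨n, hn⟩ := exists_nat_one_div_lt (sub_pos.2 hxR)
  exact hx n (by linarith)

lemma ae_eq_of_primitive_eq_right {f g : ℝ → ℝ≥0∞} (hf : Measurable f) (hg : Measurable g) {R : ℝ}
    (hfin : ∀ t, R < t → ∫⁻ x, f x * pw 0 (x - t) ≠ ∞)
    (heq : ∀ t, R < t → ∫⁻ x, f x * pw 0 (x - t) = ∫⁻ x, g x * pw 0 (x - t)) :
    ∀ᵐ x, R < x → f x = g x := by
  have key : ∀ (f : ℝ → ℝ≥0∞) (t : ℝ),
      ∫⁻ x, f (-x) * pw 0 (t - x) = ∫⁻ x, f x * pw 0 (x - (-t)) := by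
    intro f t
    rw [← lintegral_comp_neg]
    simp [sub_eq_add_neg, add_comm]
  have h := ae_eq_of_primitive_eq (f := fun x => f (-x)) (g := fun x => g (-x)) (R := -R)
    (by fun_prop) (by fun_prop) (fun t ht => by rw [key]; exact hfin _ (by linarith))
    (fun t ht => by rw [key, key]; exact heq _ (by linarith))
  have h' := (Measure.measurePreserving_neg (volume : Measure ℝ)).quasiMeasurePreserving.ae h
  filter_upwards [h'] with x hx hR
  simpa using hx (by linarith)

/-- Abel's integral equation determines its solution. -/
lemma ae_eq_of_abel_eq {α : ℝ} (h0 : 0 < α) (h1 : α < 1) {f g : ℝ → ℝ≥0∞} (hf : Measurable f)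
    (hg : Measurable g) {R : ℝ} (hfin : ∀ t < R, ∫⁻ x, f x * pw 0 (t - x) ≠ ∞)
    (heq : ∀ᵐ r, r < R → ∫⁻ u, f u * pw (α - 1) (r - u) = ∫⁻ u, g u * pw (α - 1) (r - u)) :
    ∀ᵐ x, x < R → f x = g x := by
  -- Abel's trick: integrating against the complementary power `(t - r)^(-α)` turns the fractional
  -- integral of order `α` into a multiple of the primitive.
  have key : ∀ {f : ℝ → ℝ≥0∞}, Measurable f → ∀ t,
      ∫⁻ r, (∫⁻ u, f u * pw (α - 1) (r - u)) * pw (-α) (t - r) =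
        ebeta α (1 - α) * ∫⁻ u, f u * pw 0 (t - u) := by
    intro f hf t
    simp_rw [← lintegral_mul_const' _ _ (pw_ne_top _ _)]
    rw [lintegral_lintegral_swap (by fun_prop), ← lintegral_const_mul _ (by fun_prop)]
    congr 1 with u
    simp_rw [mul_assoc]
    have := lintegral_pw_mul_pw h0 (sub_pos.2 h1) u t
    rw [show 1 - α - 1 = -α by ring, show α + (1 - α) - 1 = 0 by ring] at this
    rw [lintegral_const_mul _ (by fun_prop), this]
    ring
  refine ae_eq_of_primitive_eq hf hg hfin fun t ht => ?_
  have := (key hf t).symm.trans ((lintegral_congr_ae ?_).trans (key hg t))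
  · exact (ENNReal.mul_right_inj (ebeta_ne_zero h0 (sub_pos.2 h1)) (ebeta_ne_top _ _)).1 this
  · filter_upwards [heq] with r hr
    rcases lt_or_ge r t with h | h
    · rw [hr (h.trans ht)]
    · rw [pw_of_nonpos (sub_nonpos.2 h), mul_zero, mul_zero]

lemma ae_eq_of_abel_eq_right {α : ℝ} (h0 : 0 < α) (h1 : α < 1) {f g : ℝ → ℝ≥0∞}
    (hf : Measurable f) (hg : Measurable g) {R : ℝ}
    (hfin : ∀ t, R < t → ∫⁻ x, f x * pw 0 (x - t) ≠ ∞)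
    (heq : ∀ᵐ r, R < r → ∫⁻ u, f u * pw (α - 1) (u - r) = ∫⁻ u, g u * pw (α - 1) (u - r)) :
    ∀ᵐ x, R < x → f x = g x := by
  have key : ∀ (β : ℝ) (f : ℝ → ℝ≥0∞) (t : ℝ),
      ∫⁻ x, f (-x) * pw β (t - x) = ∫⁻ x, f x * pw β (x - (-t)) := by
    intro β f t
    rw [← lintegral_comp_neg]
    simp [sub_eq_add_neg, add_comm]
  have hneg := (Measure.measurePreserving_neg (volume : Measure ℝ)).quasiMeasurePreserving
  have h := ae_eq_of_abel_eq h0 h1 (f := fun x => f (-x)) (g := fun x => g (-x)) (R := -R)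
    (by fun_prop) (by fun_prop) (fun t ht => by rw [key]; exact hfin _ (by linarith)) (by
      filter_upwards [hneg.ae heq] with r hr hrR
      rw [key, key]
      exact hr (by linarith))
  filter_upwards [hneg.ae h] with x hx hR
  simpa using hx (by linarith)

/-! ### The Volterra kernel and its derivative in `t`. -/

/-- A nonnegative derivative of a continuous function is automatically integrable, so singular
endpoints cost nothing. -/
lemma setLIntegral_deriv {F F' : ℝ → ℝ} {s t : ℝ} (hst : s ≤ t) (hF : ContinuousOn F (Icc s t))
    (hd : ∀ x ∈ Ioo s t, HasDerivAt F (F' x) x) (h0 : ∀ x ∈ Ioo s t, 0 ≤ F' x) :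
    ∫⁻ x in Ioo s t, ENNReal.ofReal (F' x) = ENNReal.ofReal (F t - F s) := by
  have hi : IntegrableOn F' (Ioc s t) :=
    intervalIntegral.integrableOn_deriv_of_nonneg hF hd h0
  have h1 := intervalIntegral.integral_eq_sub_of_hasDerivAt_of_le hst hF hd
    ((intervalIntegrable_iff_integrableOn_Ioc_of_le hst).2 hi)
  rw [← h1, intervalIntegral.integral_of_le hst, integral_Ioc_eq_integral_Ioo,
    ofReal_integral_eq_lintegral_ofReal]
  · exact hi.mono_set Ioo_subset_Ioc_self
  · exact (ae_restrict_iff' measurableSet_Ioo).2 (Filter.Eventually.of_forall h0)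

lemma lintegral_mul_pw_mul_pw {α β s t : ℝ} {g : ℝ → ℝ} {f : ℝ → ℝ≥0∞}
    (h : ∀ r ∈ Ioo s t, f r * pw α (r - s) * pw β (t - r) = ENNReal.ofReal (g r)) :
    ∫⁻ r, f r * pw α (r - s) * pw β (t - r) = ∫⁻ r in Ioo s t, ENNReal.ofReal (g r) := by
  rw [← lintegral_indicator measurableSet_Ioo]
  congr 1 with r
  by_cases hr : r ∈ Ioo s t
  · rw [indicator_of_mem hr, h r hr]
  · rw [indicator_of_notMem hr]
    rcases le_or_gt r s with h1 | h1
    · simp [pw_of_nonpos (sub_nonpos.2 h1)]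
    · have h2 : t ≤ r := by by_contra! h2; exact hr ⟨h1, h2⟩
      simp [pw_of_nonpos (sub_nonpos.2 h2)]

/-- The Volterra kernel in `ℝ≥0∞`, without its normalising constant, with `a = H₁ - 1/2` and
`b = H₂ - 1/2`. -/
noncomputable def ker (a b t s : ℝ) : ℝ≥0∞ :=
  pw (-b) s * ∫⁻ u, pw (-a) (t - u) * pw (b - a) u * pw (b - 1) (u - s)

/-- With `u = s + (t-s)x` the kernel is `s^{-b}` times an integral over the unit interval in which
`t` enters only through `[(t-s)(s+(t-s)x)]^{b-a}`. The factor `s + 2(t-s)x` is the `t`-derivative of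
the bracket. -/
noncomputable def kerDerivAux (a b t s : ℝ) : ℝ≥0∞ :=
  ∫⁻ x, pw (-a) (1 - x) * pw (b - 1) x *
    (pw (b - a - 1) (s + (t - s) * x) * ENNReal.ofReal (s + 2 * (t - s) * x))

/-- The derivative of `ker` in its first argument. -/
noncomputable def kerDeriv (a b t s : ℝ) : ℝ≥0∞ :=
  ENNReal.ofReal (b - a) * pw (-b) s * pw (b - a - 1) (t - s) * kerDerivAux a b t s

@[fun_prop]
lemma measurable_kerDerivAux (a b : ℝ) : Measurable fun p : ℝ × ℝ => kerDerivAux a b p.1 p.2 := by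
  unfold kerDerivAux
  exact Measurable.lintegral_prod_right' (f := fun p : (ℝ × ℝ) × ℝ =>
    pw (-a) (1 - p.2) * pw (b - 1) p.2 * (pw (b - a - 1) (p.1.2 + (p.1.1 - p.1.2) * p.2) *
      ENNReal.ofReal (p.1.2 + 2 * (p.1.1 - p.1.2) * p.2))) (by fun_prop)

@[fun_prop]
lemma measurable_kerDeriv {ι : Type*} [MeasurableSpace ι] (a b : ℝ) {f g : ι → ℝ}
    (hf : Measurable f) (hg : Measurable g) : Measurable fun x => kerDeriv a b (f x) (g x) := by
  have : Measurable fun x => kerDerivAux a b (f x) (g x) :=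
    (measurable_kerDerivAux a b).comp (hf.prodMk hg)
  unfold kerDeriv
  fun_prop

@[fun_prop]
lemma measurable_ker {ι : Type*} [MeasurableSpace ι] (a b : ℝ) {f g : ι → ℝ}
    (hf : Measurable f) (hg : Measurable g) : Measurable fun x => ker a b (f x) (g x) := by
  have : Measurable fun x => ∫⁻ u, pw (-a) (f x - u) * pw (b - a) u * pw (b - 1) (u - g x) :=
    Measurable.lintegral_prod_right' (f := fun p : ι × ℝ =>
      pw (-a) (f p.1 - p.2) * pw (b - a) p.2 * pw (b - 1) (p.2 - g p.1)) (by fun_prop)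
  unfold ker
  fun_prop

lemma kerDeriv_of_nonpos {a b t s : ℝ} (hs : s ≤ 0) : kerDeriv a b t s = 0 := by
  simp [kerDeriv, pw_of_nonpos hs]

lemma kerDeriv_of_le {a b t s : ℝ} (h : t ≤ s) : kerDeriv a b t s = 0 := by
  simp [kerDeriv, pw_of_nonpos (sub_nonpos.2 h)]

lemma ker_of_le {a b t s : ℝ} (h : t ≤ s) : ker a b t s = 0 := by
  have : ∀ u, pw (-a) (t - u) * pw (b - a) u * pw (b - 1) (u - s) = 0 := by
    intro u
    rcases le_or_gt u s with hu | hu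
    · rw [pw_of_nonpos (x := u - s) (by linarith), mul_zero]
    · rw [pw_of_nonpos (x := t - u) (by linarith)]; simp
  simp [ker, this]

lemma ker_eq_lintegral_unit {a b t s : ℝ} (h : s < t) :
    ker a b t s = pw (-b) s * pw (b - a) (t - s) *
      ∫⁻ x, pw (-a) (1 - x) * pw (b - 1) x * pw (b - a) (s + (t - s) * x) := by
  have hl : 0 < t - s := sub_pos.2 h
  have key : ∀ x, pw (-a) (t - (s + (t - s) * x)) * pw (b - a) (s + (t - s) * x) *
      pw (b - 1) (s + (t - s) * x - s) = (pw (-a) (t - s) * pw (b - 1) (t - s)) *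
        (pw (-a) (1 - x) * pw (b - 1) x * pw (b - a) (s + (t - s) * x)) := by
    intro x
    rw [show t - (s + (t - s) * x) = (t - s) * (1 - x) by ring,
      show s + (t - s) * x - s = (t - s) * x by ring, pw_mul hl, pw_mul hl]
    ring
  rw [ker, lintegral_affine _ s hl]
  simp_rw [key]
  rw [lintegral_const_mul' _ _ (ENNReal.mul_ne_top (pw_ne_top _ _) (pw_ne_top _ _)),
    show b - a = 1 + (-a + (b - 1)) by ring, pw_add 1, pw_add (-a) _ (t - s), pw_of_pos hl (α := 1),
    Real.rpow_one]
  ring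

/-- `ker` is the primitive of `kerDeriv`. -/
lemma ker_eq_lintegral_kerDeriv {a b : ℝ} (hab : a < b) (t s : ℝ) :
    ker a b t s = ∫⁻ r, kerDeriv a b r s * pw 0 (t - r) := by
  rcases le_or_gt s 0 with hs | hs
  · simp [ker, pw_of_nonpos hs, kerDeriv_of_nonpos hs]
  rcases le_or_gt t s with hts | hts
  · have : ∀ r, kerDeriv a b r s * pw 0 (t - r) = 0 := by
      intro r
      rcases le_or_gt r s with hr | hr
      · rw [kerDeriv_of_le hr, zero_mul]
      · rw [pw_of_nonpos (x := t - r) (by linarith), mul_zero]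
    simp [this, ker_of_le hts]
  have hc : 0 < b - a := sub_pos.2 hab
  set c := b - a with hcdef
  -- For fixed `x` the integrand is the derivative of `[(r-s)(s+(r-s)x)]^c`, whose value at `r = s`
  -- is zero because `c > 0`.
  have inner : ∀ x ∈ Ioo (0 : ℝ) 1, ∫⁻ r, (ENNReal.ofReal c * (pw (c - 1) (s + (r - s) * x) *
      ENNReal.ofReal (s + 2 * (r - s) * x))) * pw (c - 1) (r - s) * pw 0 (t - r) =
        pw c (t - s) * pw c (s + (t - s) * x) := by
    intro x hx
    have hpos : ∀ r, s ≤ r → 0 < s + (r - s) * x := fun r hr => by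
      have := mul_nonneg (sub_nonneg.2 hr) hx.1.le
      linarith
    rw [lintegral_mul_pw_mul_pw (g := fun r =>
      (1 * (s + (r - s) * x) + (r - s) * (1 * x)) * c *
        ((r - s) * (s + (r - s) * x)) ^ (c - 1)), setLIntegral_deriv hts.le
        (F := fun r => ((r - s) * (s + (r - s) * x)) ^ c)]
    · have : (0 : ℝ) < s + (t - s) * x := hpos t hts.le
      rw [pw_of_pos (sub_pos.2 hts), pw_of_pos this,
        ← ENNReal.ofReal_mul (Real.rpow_nonneg (by linarith) _),
        ← Real.mul_rpow (by linarith) this.le]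
      simp [Real.zero_rpow hc.ne']
    · exact ContinuousOn.rpow_const (by fun_prop) fun _ _ => Or.inr hc.le
    · intro r hr
      refine HasDerivAt.rpow_const ?_ (Or.inl ?_)
      · have h1 : HasDerivAt (fun r : ℝ => r - s) 1 r := (hasDerivAt_id r).sub_const s
        exact h1.mul ((h1.mul_const x).const_add s)
      · exact (mul_pos (sub_pos.2 hr.1) (hpos r hr.1.le)).ne'
    · intro r hr
      have := hpos r hr.1.le
      have := hx.1
      have := sub_pos.2 hr.1
      positivity
    · intro r hr
      have h1 := hpos r hr.1.le
      have h2 := sub_pos.2 hr.1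
      have h3 := hx.1
      rw [pw_of_pos h1, pw_of_pos h2, pw_zero_of_pos (sub_pos.2 hr.2), mul_one,
        ← ENNReal.ofReal_mul (by positivity), ← ENNReal.ofReal_mul (by positivity),
        ← ENNReal.ofReal_mul (by positivity), Real.mul_rpow h2.le h1.le]
      congr 1
      ring
  rw [ker_eq_lintegral_unit hts]
  have e1 : ∀ r, kerDeriv a b r s * pw 0 (t - r) = pw (-b) s * ∫⁻ x,
      pw (-a) (1 - x) * pw (b - 1) x * ((ENNReal.ofReal c * (pw (c - 1) (s + (r - s) * x) *
      ENNReal.ofReal (s + 2 * (r - s) * x))) * pw (c - 1) (r - s) * pw 0 (t - r)) := by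
    intro r
    rw [kerDeriv, kerDerivAux, ← hcdef, show ∀ p q r m n : ℝ≥0∞, p * q * r * m * n =
      q * ((p * (r * n)) * m) by intros; ring, ← lintegral_const_mul' _ _ (by
        finiteness [pw_ne_top (c - 1) (r - s), pw_ne_top 0 (t - r)])]
    congr 2 with x
    ring
  simp_rw [e1]
  rw [lintegral_const_mul' _ _ (pw_ne_top _ _), lintegral_lintegral_swap (by fun_prop), mul_assoc,
    ← lintegral_const_mul' _ _ (pw_ne_top _ _)]
  congr 2 with x
  rw [lintegral_const_mul' _ _ (ENNReal.mul_ne_top (pw_ne_top _ _) (pw_ne_top _ _))]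
  rcases le_or_gt x 0 with hx | hx
  · simp [pw_of_nonpos hx]
  rcases le_or_gt 1 x with hx1 | hx1
  · simp [pw_of_nonpos (sub_nonpos.2 hx1)]
  rw [inner x ⟨hx, hx1⟩]
  ring

/-! ### Bounds, homogeneity and continuity of the derivative. -/

/-- Since `s + 2(t-s)x ≤ 2(s+(t-s)x)`, the linear factor raises the exponent `b-a-1` to `b-a > 0`,
and monotonicity then replaces the base by `t`. The bound is a beta integrand, free of `s`, and
serves also for dominated convergence. -/
lemma kerDerivAux_integrand_le {a b t s x : ℝ} (hab : a < b) (hs : 0 < s) (hst : s < t)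
    (hx : x < 1) :
    pw (-a) (1 - x) * pw (b - 1) x *
      (pw (b - a - 1) (s + (t - s) * x) * ENNReal.ofReal (s + 2 * (t - s) * x)) ≤
    pw (-a) (1 - x) * pw (b - 1) x * (2 * pw (b - a) t) := by
  rcases le_or_gt x 0 with hx0 | hx0
  · simp [pw_of_nonpos hx0]
  have hl := sub_pos.2 hst
  have h1 : 0 < s + (t - s) * x := by positivity
  have h2 : s + (t - s) * x ≤ t := by nlinarith
  have h3 : s + 2 * (t - s) * x ≤ 2 * (s + (t - s) * x) := by nlinarith
  refine mul_le_mul' le_rfl ?_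
  calc _ ≤ pw (b - a - 1) (s + (t - s) * x) * ENNReal.ofReal (2 * (s + (t - s) * x)) := by
        gcongr
    _ = 2 * (pw (b - a - 1) (s + (t - s) * x) * pw 1 (s + (t - s) * x)) := by
        rw [ENNReal.ofReal_mul (by norm_num), pw_of_pos (α := 1) h1, Real.rpow_one]
        simp; ring
    _ = 2 * pw (b - a) (s + (t - s) * x) := by rw [← pw_add]; ring_nf
    _ ≤ _ := by gcongr; exact pw_le_pw (by linarith) h2

lemma kerDerivAux_le {a b t s : ℝ} (ha1 : a < 1) (hab : a < b) (hb : 0 < b) (hs : 0 < s)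
    (hst : s < t) :
    kerDerivAux a b t s ≤ 2 * pw (b - a) t * ebeta b (1 - a) := by
  rw [← lintegral_pw_mul_pw_one hb (sub_pos.2 ha1), ← lintegral_const_mul' _ _
    (ENNReal.mul_ne_top (by simp) (pw_ne_top _ _)), kerDerivAux]
  refine lintegral_mono fun x => ?_
  rcases le_or_gt 1 x with hx1 | hx1
  · simp [pw_of_nonpos (sub_nonpos.2 hx1)]
  calc _ ≤ pw (-a) (1 - x) * pw (b - 1) x * (2 * pw (b - a) t) :=
        kerDerivAux_integrand_le hab hs hst hx1
    _ = _ := by rw [show 1 - a - 1 = -a by ring]; ring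

lemma le_kerDerivAux {a b t s : ℝ} (ha1 : a < 1) (hab : a < b) (hb : 0 < b) (hs : 0 < s)
    (hst : s < t) :
    pw (b - a) t * ebeta (b + (b - a)) (1 - a) ≤ kerDerivAux a b t s := by
  rw [← lintegral_pw_mul_pw_one (by linarith) (sub_pos.2 ha1), ← lintegral_const_mul' _ _
    (pw_ne_top _ _), kerDerivAux]
  refine lintegral_mono fun x => ?_
  rcases le_or_gt x 0 with hx | hx
  · simp [pw_of_nonpos hx]
  rcases le_or_gt 1 x with hx1 | hx1
  · simp [pw_of_nonpos (sub_nonpos.2 hx1)]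
  have hl := sub_pos.2 hst
  have h1 : 0 < s + (t - s) * x := by positivity
  have h2 : t * x ≤ s + (t - s) * x := by nlinarith
  have h3 : s + (t - s) * x ≤ s + 2 * (t - s) * x := by nlinarith [mul_pos hl hx]
  have h4 : pw (b - a) t * pw (b - a) x ≤
      pw (b - a - 1) (s + (t - s) * x) * ENNReal.ofReal (s + 2 * (t - s) * x) := by
    calc _ = pw (b - a) (t * x) := (pw_mul (hs.trans hst)).symm
      _ ≤ pw (b - a) (s + (t - s) * x) := pw_le_pw (by linarith) h2
      _ = pw (b - a - 1) (s + (t - s) * x) * pw 1 (s + (t - s) * x) := by rw [← pw_add]; ring_nf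
      _ = pw (b - a - 1) (s + (t - s) * x) * ENNReal.ofReal (s + (t - s) * x) := by
          rw [pw_of_pos (α := 1) h1, Real.rpow_one]
      _ ≤ _ := by gcongr
  calc _ = pw (-a) (1 - x) * pw (b - 1) x * (pw (b - a) t * pw (b - a) x) := by
        rw [show 1 - a - 1 = -a by ring, show b + (b - a) - 1 = (b - 1) + (b - a) by ring, pw_add]
        ring
    _ ≤ _ := by gcongr

/-- The upper half of the two-sided bound `kerDeriv t s ≍ s^{-b} t^{b-a} (t-s)^{b-a-1}`. -/
lemma kerDeriv_le {a b : ℝ} (ha1 : a < 1) (hab : a < b) (hb : 0 < b) (t s : ℝ) :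
    kerDeriv a b t s ≤ (ENNReal.ofReal (b - a) * 2 * ebeta b (1 - a)) *
      (pw (-b) s * pw (b - a) t * pw (b - a - 1) (t - s)) := by
  rcases le_or_gt s 0 with hs | hs
  · simp [kerDeriv_of_nonpos hs]
  rcases le_or_gt t s with hst | hst
  · simp [kerDeriv_of_le hst]
  calc _ ≤ ENNReal.ofReal (b - a) * pw (-b) s * pw (b - a - 1) (t - s) *
        (2 * pw (b - a) t * ebeta b (1 - a)) := by
        rw [kerDeriv]; gcongr; exact kerDerivAux_le ha1 hab hb hs hst
    _ = _ := by ring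

/-- The lower bound serves two purposes: the kernel is positive on `0 < s < t`, and finiteness of an
integral against it bounds integrals of the other factor. -/
lemma le_kerDeriv {a b : ℝ} (ha1 : a < 1) (hab : a < b) (hb : 0 < b) (t s : ℝ) :
    (ENNReal.ofReal (b - a) * ebeta (b + (b - a)) (1 - a)) *
      (pw (-b) s * pw (b - a) t * pw (b - a - 1) (t - s)) ≤ kerDeriv a b t s := by
  rcases le_or_gt s 0 with hs | hs
  · simp [pw_of_nonpos hs]
  rcases le_or_gt t s with hst | hst
  · simp [pw_of_nonpos (sub_nonpos.2 hst)]
  calc _ = ENNReal.ofReal (b - a) * pw (-b) s * pw (b - a - 1) (t - s) *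
        (pw (b - a) t * ebeta (b + (b - a)) (1 - a)) := by ring
    _ ≤ _ := by
      rw [kerDeriv]; gcongr; exact le_kerDerivAux ha1 hab hb hs hst

lemma kerDeriv_ne_top {a b : ℝ} (ha1 : a < 1) (hab : a < b) (hb : 0 < b) (t s : ℝ) :
    kerDeriv a b t s ≠ ∞ :=
  ne_top_of_le_ne_top (by
    finiteness [ebeta_ne_top b (1 - a), pw_ne_top (-b) s, pw_ne_top (b - a) t,
      pw_ne_top (b - a - 1) (t - s)])
    (kerDeriv_le ha1 hab hb t s)

lemma kerDeriv_ne_zero {a b : ℝ} (ha1 : a < 1) (hab : a < b) (hb : 0 < b) {t s : ℝ} (hs : 0 < s)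
    (hst : s < t) : kerDeriv a b t s ≠ 0 := by
  refine ne_of_gt (lt_of_lt_of_le (pos_iff_ne_zero.2 ?_) (le_kerDeriv ha1 hab hb t s))
  have h1 : ENNReal.ofReal (b - a) ≠ 0 := by simpa using hab
  have h2 : ebeta (b + (b - a)) (1 - a) ≠ 0 := ebeta_ne_zero (by linarith) (by linarith)
  exact mul_ne_zero (mul_ne_zero h1 h2) (mul_ne_zero (mul_ne_zero (pw_ne_zero hs)
    (pw_ne_zero (hs.trans hst))) (pw_ne_zero (sub_pos.2 hst)))

lemma kerDeriv_smul {a b l : ℝ} (hl : 0 < l) (t s : ℝ) :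
    kerDeriv a b (l * t) (l * s) = pw (2 * (b - a) - b - 1) l * kerDeriv a b t s := by
  have : kerDerivAux a b (l * t) (l * s) = pw (b - a) l * kerDerivAux a b t s := by
    rw [kerDerivAux, kerDerivAux, ← lintegral_const_mul' _ _ (pw_ne_top _ _)]
    congr 1 with x
    rw [show l * s + (l * t - l * s) * x = l * (s + (t - s) * x) by ring,
      show l * s + 2 * (l * t - l * s) * x = l * (s + 2 * (t - s) * x) by ring, pw_mul hl,
      ENNReal.ofReal_mul hl.le, show b - a = (b - a - 1) + 1 by ring, pw_add _ 1,
      pw_of_pos (α := 1) hl, Real.rpow_one, show b - a - 1 + 1 - 1 = b - a - 1 by ring]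
    ring
  rw [kerDeriv, kerDeriv, this, ← mul_sub, pw_mul hl, pw_mul hl,
    show 2 * (b - a) - b - 1 = -b + ((b - a - 1) + (b - a)) by ring, pw_add, pw_add _ (b - a)]
  ring

lemma continuousAt_pw (α : ℝ) {x : ℝ} (hx : 0 < x) : ContinuousAt (pw α) x := by
  have : ContinuousAt (fun x : ℝ => ENNReal.ofReal (x ^ α)) x :=
    ENNReal.continuous_ofReal.continuousAt.comp (Real.continuousAt_rpow_const x α (Or.inl hx.ne'))
  refine this.congr ?_
  filter_upwards [lt_mem_nhds hx] with y hy
  exact (pw_of_pos hy).symm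

/-- Being a primitive gives differentiability only almost everywhere; continuity of the integrand
makes `kerDeriv` the derivative at every point, as `volterraKernelDeriv` requires. -/
lemma continuousAt_kerDeriv {a b : ℝ} (ha1 : a < 1) (hab : a < b) (hb : 0 < b) {t s : ℝ}
    (hs : 0 < s) (hst : s < t) : ContinuousAt (fun r => kerDeriv a b r s) t := by
  have haux : ContinuousAt (fun r => kerDerivAux a b r s) t := by
    refine tendsto_lintegral_filter_of_dominated_convergence
      (fun x => pw (-a) (1 - x) * pw (b - 1) x * (2 * pw (b - a) (t + 1))) ?_ ?_ ?_ ?_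
    · exact Filter.Eventually.of_forall fun r => by fun_prop
    · filter_upwards [lt_mem_nhds hst, gt_mem_nhds (show t < t + 1 by linarith)] with r hr hr1
      refine Filter.Eventually.of_forall fun x => ?_
      rcases le_or_gt 1 x with hx1 | hx1
      · simp [pw_of_nonpos (sub_nonpos.2 hx1)]
      refine (kerDerivAux_integrand_le hab hs hr hx1).trans ?_
      gcongr
      exact pw_le_pw (by linarith) hr1.le
    · have : ∀ x, pw (-a) (1 - x) * pw (b - 1) x * (2 * pw (b - a) (t + 1)) =
          (2 * pw (b - a) (t + 1)) * (pw (b - 1) x * pw (1 - a - 1) (1 - x)) := by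
        intro x; rw [show 1 - a - 1 = -a by ring]; ring
      simp_rw [this]
      rw [lintegral_const_mul _ (by fun_prop), lintegral_pw_mul_pw_one hb (by linarith)]
      finiteness [pw_ne_top (b - a) (t + 1), ebeta_ne_top b (1 - a)]
    · refine Filter.Eventually.of_forall fun x => ?_
      rcases le_or_gt x 0 with hx | hx
      · simp [pw_of_nonpos hx]
      have h1 : 0 < s + (t - s) * x := by have := sub_pos.2 hst; positivity
      have h2 : 0 < s + 2 * (t - s) * x := by have := sub_pos.2 hst; positivity
      have c1 : ContinuousAt (fun r => pw (b - a - 1) (s + (r - s) * x)) t :=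
        ContinuousAt.comp (g := pw (b - a - 1)) (continuousAt_pw _ h1) (by fun_prop)
      have c2 : ContinuousAt (fun r => ENNReal.ofReal (s + 2 * (r - s) * x)) t :=
        ENNReal.continuous_ofReal.continuousAt.comp (by fun_prop)
      refine ENNReal.Tendsto.const_mul (ENNReal.Tendsto.mul c1 (Or.inr ENNReal.ofReal_ne_top) c2
        (Or.inr (pw_ne_top _ _))) (Or.inr ?_)
      finiteness [pw_ne_top (-a) (1 - x), pw_ne_top (b - 1) x]
  have c1 : ContinuousAt (fun r => pw (b - a - 1) (r - s)) t :=
    ContinuousAt.comp (g := pw (b - a - 1)) (continuousAt_pw _ (sub_pos.2 hst)) (by fun_prop)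
  unfold kerDeriv
  have hfin : kerDerivAux a b t s ≠ ∞ := by
    refine ne_top_of_le_ne_top ?_ (kerDerivAux_le ha1 hab hb hs hst)
    finiteness [pw_ne_top (b - a) t, ebeta_ne_top b (1 - a)]
  refine ENNReal.Tendsto.mul (ENNReal.Tendsto.const_mul c1 (Or.inr ?_)) (Or.inr hfin) haux
    (Or.inr ?_)
  · finiteness [pw_ne_top (-b) s]
  · finiteness [pw_ne_top (-b) s, pw_ne_top (b - a - 1) (t - s)]

lemma ker_ne_top {a b : ℝ} (ha1 : a < 1) (hab : a < b) (hb : 0 < b) (t s : ℝ) :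
    ker a b t s ≠ ∞ := by
  rcases le_or_gt t s with hst | hst
  · simp [ker_of_le hst]
  have h : ∫⁻ u, pw (-a) (t - u) * pw (b - a) u * pw (b - 1) (u - s) ≤
      pw (b - a) t * ∫⁻ u, pw (b - 1) (u - s) * pw (1 - a - 1) (t - u) := by
    rw [← lintegral_const_mul' _ _ (pw_ne_top _ _)]
    refine lintegral_mono fun u => ?_
    rcases le_or_gt t u with hu | hu
    · simp [pw_of_nonpos (sub_nonpos.2 hu)]
    calc _ ≤ pw (-a) (t - u) * pw (b - a) t * pw (b - 1) (u - s) := by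
          gcongr; exact pw_le_pw (by linarith) hu.le
      _ = _ := by rw [show 1 - a - 1 = -a by ring]; ring
  rw [lintegral_pw_mul_pw hb (by linarith)] at h
  refine ENNReal.mul_ne_top (pw_ne_top _ _) (ne_top_of_le_ne_top ?_ h)
  finiteness [pw_ne_top (b - a) t, pw_ne_top (b + (1 - a) - 1) (t - s), ebeta_ne_top b (1 - a)]

/-! ### Comparison with the real-valued kernels. -/

lemma volterraKernel_eq {H₁ H₂ t s : ℝ} (hs : 0 < s) (hst : s < t) :
    volterraKernel H₁ H₂ t s =
      betaH H₂ * (ker (H₁ - 1 / 2) (H₂ - 1 / 2) t s).toReal := by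
  rw [volterraKernel, ker, ENNReal.toReal_mul, toReal_pw hs, mul_assoc,
    show -(H₂ - 1 / 2) = 1 / 2 - H₂ by ring, show -(H₁ - 1 / 2) = 1 / 2 - H₁ by ring,
    show H₂ - 1 / 2 - (H₁ - 1 / 2) = H₂ - H₁ by ring, show H₂ - 1 / 2 - 1 = H₂ - 3 / 2 by ring]
  congr 2
  have hind : ∫⁻ u, pw (1 / 2 - H₁) (t - u) * pw (H₂ - H₁) u * pw (H₂ - 3 / 2) (u - s) =
      ∫⁻ u in Ioo s t, pw (1 / 2 - H₁) (t - u) * pw (H₂ - H₁) u * pw (H₂ - 3 / 2) (u - s) := by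
    rw [← lintegral_indicator measurableSet_Ioo]
    congr 1 with u
    by_cases hu : u ∈ Ioo s t
    · rw [indicator_of_mem hu]
    · rw [indicator_of_notMem hu]
      rcases le_or_gt u s with h1 | h1
      · simp [pw_of_nonpos (sub_nonpos.2 h1)]
      · have h2 : t ≤ u := by by_contra! h2; exact hu ⟨h1, h2⟩
        simp [pw_of_nonpos (sub_nonpos.2 h2)]
  rw [hind, intervalIntegral.integral_of_le hst.le, integral_Ioc_eq_integral_Ioo,
    ← integral_toReal (by fun_prop) (Filter.Eventually.of_forall fun u => by
      finiteness [pw_ne_top (1 / 2 - H₁) (t - u), pw_ne_top (H₂ - H₁) u,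
        pw_ne_top (H₂ - 3 / 2) (u - s)])]
  refine setIntegral_congr_fun measurableSet_Ioo fun u hu => ?_
  simp only [ENNReal.toReal_mul]
  rw [toReal_pw (sub_pos.2 hu.1), toReal_pw (sub_pos.2 hu.2), toReal_pw (hs.trans hu.1)]

lemma toReal_ker_eq_integral {a b : ℝ} (ha1 : a < 1) (hab : a < b) (hb : 0 < b) {t s : ℝ}
    (hst : s ≤ t) :
    IntervalIntegrable (fun r => (kerDeriv a b r s).toReal) volume s t ∧
      (ker a b t s).toReal = ∫ r in s..t, (kerDeriv a b r s).toReal := by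
  have hind : ker a b t s = ∫⁻ r in Ioc s t, kerDeriv a b r s := by
    rw [ker_eq_lintegral_kerDeriv hab, ← restrict_Ioo_eq_restrict_Ioc,
      ← lintegral_indicator measurableSet_Ioo]
    congr 1 with r
    by_cases hr : r ∈ Ioo s t
    · rw [indicator_of_mem hr, pw_zero_of_pos (sub_pos.2 hr.2), mul_one]
    · rw [indicator_of_notMem hr]
      rcases le_or_gt r s with h1 | h1
      · simp [kerDeriv_of_le h1]
      · have h2 : t ≤ r := by by_contra! h2; exact hr ⟨h1, h2⟩
        simp [pw_of_nonpos (sub_nonpos.2 h2)]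
  have hfin : ∀ᵐ r ∂(volume.restrict (Ioc s t)), kerDeriv a b r s < ∞ :=
    Filter.Eventually.of_forall fun r => (kerDeriv_ne_top ha1 hab hb r s).lt_top
  constructor
  · rw [intervalIntegrable_iff_integrableOn_Ioc_of_le hst]
    exact integrable_toReal_of_lintegral_ne_top (by fun_prop)
      (hind ▸ ker_ne_top ha1 hab hb t s)
  · rw [hind, intervalIntegral.integral_of_le hst, integral_toReal (by fun_prop) hfin]

lemma volterraKernelDeriv_eq {H₁ H₂ : ℝ} (hH₁ : 1 / 2 < H₁) (hH₁₂ : H₁ < H₂) (hH₂ : H₂ < 1)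
    {t s : ℝ} (hs : 0 < s) (hst : s < t) :
    volterraKernelDeriv H₁ H₂ t s =
      betaH H₂ * (kerDeriv (H₁ - 1 / 2) (H₂ - 1 / 2) t s).toReal := by
  have ha1 : H₁ - 1 / 2 < 1 := by linarith
  have hab : H₁ - 1 / 2 < H₂ - 1 / 2 := by linarith
  have hb : 0 < H₂ - 1 / 2 := by linarith
  have h1 : HasDerivAt
      (fun x => ∫ r in s..x, (kerDeriv (H₁ - 1 / 2) (H₂ - 1 / 2) r s).toReal)
      (kerDeriv (H₁ - 1 / 2) (H₂ - 1 / 2) t s).toReal t := by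
    refine intervalIntegral.integral_hasDerivAt_right
      (toReal_ker_eq_integral ha1 hab hb hst.le).1 ?_ ?_
    · exact (Measurable.stronglyMeasurable (by fun_prop)).stronglyMeasurableAtFilter
    · exact (ENNReal.tendsto_toReal (kerDeriv_ne_top ha1 hab hb t s)).comp
        (continuousAt_kerDeriv ha1 hab hb hs hst)
  refine HasDerivAt.deriv ((h1.const_mul (betaH H₂)).congr_of_eventuallyEq ?_)
  filter_upwards [lt_mem_nhds hst] with x hx
  rw [volterraKernel_eq hs hx, (toReal_ker_eq_integral ha1 hab hb hx.le).2]

/-- The kernel `k(s,u)` in `ℝ≥0∞`, without its constant. -/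
noncomputable def covKer (a b s u : ℝ) : ℝ≥0∞ := ∫⁻ v, kerDeriv a b s v * kerDeriv a b u v

@[fun_prop]
lemma measurable_covKer {ι : Type*} [MeasurableSpace ι] (a b : ℝ) {f g : ι → ℝ}
    (hf : Measurable f) (hg : Measurable g) : Measurable fun x => covKer a b (f x) (g x) :=
  Measurable.lintegral_prod_right' (f := fun p : ι × ℝ =>
    kerDeriv a b (f p.1) p.2 * kerDeriv a b (g p.1) p.2) (by fun_prop)

/-- This covers the diagonal `s = u` too. There the integral diverges, because `2(b-a-1) < -1`, and
both sides take the default value zero: a non-integrable Bochner integral and `toReal` of `∞`. -/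
lemma kernelk_eq {H₁ H₂ : ℝ} (hH₁ : 1 / 2 < H₁) (hH₁₂ : H₁ < H₂) (hH₂ : H₂ < 1)
    {s u : ℝ} (hs : 0 < s) (hu : 0 < u) :
    kernelk H₁ H₂ s u =
      betaH H₂ ^ 2 * (covKer (H₁ - 1 / 2) (H₂ - 1 / 2) s u).toReal := by
  have ha1 : H₁ - 1 / 2 < 1 := by linarith
  have hab : H₁ - 1 / 2 < H₂ - 1 / 2 := by linarith
  have hb : 0 < H₂ - 1 / 2 := by linarith
  set a := H₁ - 1 / 2
  set b := H₂ - 1 / 2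
  have hind : covKer a b s u = ∫⁻ v in Ioo 0 (min s u), kerDeriv a b s v * kerDeriv a b u v := by
    rw [covKer, ← lintegral_indicator measurableSet_Ioo]
    congr 1 with v
    by_cases hv : v ∈ Ioo 0 (min s u)
    · rw [indicator_of_mem hv]
    · rw [indicator_of_notMem hv]
      rcases le_or_gt v 0 with h1 | h1
      · simp [kerDeriv_of_nonpos h1]
      · have h2 : min s u ≤ v := by by_contra! h2; exact hv ⟨h1, h2⟩
        rcases min_le_iff.1 h2 with h | h <;> simp [kerDeriv_of_le h]
  rw [kernelk, intervalIntegral.integral_of_le (le_min hs.le hu.le), integral_Ioc_eq_integral_Ioo,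
    hind, ← integral_toReal (by fun_prop) (Filter.Eventually.of_forall fun v =>
      (ENNReal.mul_ne_top (kerDeriv_ne_top ha1 hab hb s v)
        (kerDeriv_ne_top ha1 hab hb u v)).lt_top), ← integral_const_mul]
  refine setIntegral_congr_fun measurableSet_Ioo fun v hv => ?_
  have hv' := lt_min_iff.1 hv.2
  simp only [ENNReal.toReal_mul]
  rw [volterraKernelDeriv_eq hH₁ hH₁₂ hH₂ hv.1 hv'.1, volterraKernelDeriv_eq hH₁ hH₁₂ hH₂ hv.1 hv'.2]
  ring

/-! ### The explicit function solves the equation. -/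

lemma ebeta_comm (α β : ℝ) : ebeta α β = ebeta β α := by
  rw [ebeta, ebeta, ProbabilityTheory.beta, ProbabilityTheory.beta, mul_comm, add_comm]

lemma lintegral_pw_mul_pw_comm {α β : ℝ} (hα : 0 < α) (hβ : 0 < β) (x y : ℝ) :
    ∫⁻ u, pw (α - 1) (u - x) * pw (β - 1) (y - u) =
      ∫⁻ u, pw (β - 1) (u - x) * pw (α - 1) (y - u) := by
  rw [lintegral_pw_mul_pw hα hβ, lintegral_pw_mul_pw hβ hα, ebeta_comm, add_comm]

lemma lintegral_pw_mul_pw_zero_comm {α : ℝ} (hα : 0 < α) (x y : ℝ) :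
    ∫⁻ u, pw (α - 1) (u - x) * pw 0 (y - u) = ∫⁻ u, pw 0 (u - x) * pw (α - 1) (y - u) := by
  simpa using lintegral_pw_mul_pw_comm hα one_pos x y

lemma lintegral_pw_mul_pw_zero {α : ℝ} (hα : 0 < α) (x y : ℝ) :
    ∫⁻ u, pw (α - 1) (u - x) * pw 0 (y - u) = ebeta α 1 * pw α (y - x) := by
  simpa using lintegral_pw_mul_pw hα one_pos x y

/-- The beta integral with complementary exponents. -/
lemma lintegral_pw_mul_pw_compl {α : ℝ} (h0 : 0 < α) (h1 : α < 1) (x y : ℝ) :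
    ∫⁻ u, pw (α - 1) (u - x) * pw (-α) (y - u) = ebeta α (1 - α) * pw 0 (y - x) := by
  have := lintegral_pw_mul_pw h0 (sub_pos.2 h1) x y
  rwa [show 1 - α - 1 = -α by ring, show α + (1 - α) - 1 = 0 by ring] at this

lemma lintegral_pw_mul_pw_compl' {α : ℝ} (h0 : 0 < α) (h1 : α < 1) (x y : ℝ) :
    ∫⁻ u, pw (-α) (u - x) * pw (α - 1) (y - u) = ebeta α (1 - α) * pw 0 (y - x) := by
  have := lintegral_pw_mul_pw_compl (α := 1 - α) (by linarith) (by linarith) x y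
  rwa [show 1 - α - 1 = -α by ring, show -(1 - α) = α - 1 by ring, show 1 - (1 - α) = α by ring,
    ebeta_comm] at this

lemma lintegral_pw_mul_pw_mul_zero_le {c β : ℝ} (hc : 0 ≤ c) (hβ : 0 < β) (v t : ℝ) :
    ∫⁻ u, pw c u * pw (β - 1) (u - v) * pw 0 (t - u) ≤
      pw c t * (ebeta β 1 * pw β (t - v)) := by
  rw [← lintegral_pw_mul_pw_zero hβ, ← lintegral_const_mul' _ _ (pw_ne_top _ _)]
  refine lintegral_mono fun u => ?_
  rcases le_or_gt t u with hu | hu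
  · simp [pw_of_nonpos (sub_nonpos.2 hu)]
  rw [mul_assoc]
  gcongr
  exact pw_le_pw hc hu.le

/-- Composition of the Volterra operator with the right-sided fractional integral of order `a`. -/
lemma lintegral_kerDeriv_mul_pw {a b : ℝ} (ha : 0 < a) (ha1 : a < 1) (hab : a < b) (v R : ℝ) :
    ∀ᵐ x, x < R → ∫⁻ s, kerDeriv a b s v * pw (a - 1) (x - s) =
      ebeta a (1 - a) * pw (-b) v * (pw (b - a) x * pw (b - 1) (x - v)) := by
  have hb : 0 < b := ha.trans hab
  -- The primitive commutes with the fractional integral of order `a` and turns `kerDeriv` into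
  -- `ker`. Since `ker` is itself a fractional integral of order `1 - a`, up to constants, the two
  -- orders add up to a plain primitive.
  have hprim : ∀ t, ∫⁻ x, (∫⁻ s, kerDeriv a b s v * pw (a - 1) (x - s)) * pw 0 (t - x) =
      ∫⁻ x, ebeta a (1 - a) * pw (-b) v * (pw (b - a) x * pw (b - 1) (x - v)) * pw 0 (t - x) := by
    intro t
    calc ∫⁻ x, (∫⁻ s, kerDeriv a b s v * pw (a - 1) (x - s)) * pw 0 (t - x)
        = ∫⁻ x, ∫⁻ s, kerDeriv a b s v * pw (a - 1) (x - s) * pw 0 (t - x) := by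
          simp_rw [lintegral_mul_const' _ _ (pw_ne_top _ _)]
      _ = ∫⁻ s, ∫⁻ x, kerDeriv a b s v * pw (a - 1) (x - s) * pw 0 (t - x) :=
          lintegral_lintegral_swap (by fun_prop)
      _ = ∫⁻ s, ∫⁻ r, kerDeriv a b s v * pw 0 (r - s) * pw (a - 1) (t - r) := by
          congr 1 with s
          simp_rw [mul_assoc]
          rw [lintegral_const_mul _ (by fun_prop), lintegral_const_mul _ (by fun_prop),
            lintegral_pw_mul_pw_zero_comm ha]
      _ = ∫⁻ r, ∫⁻ s, kerDeriv a b s v * pw 0 (r - s) * pw (a - 1) (t - r) :=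
          lintegral_lintegral_swap (by fun_prop)
      _ = ∫⁻ r, pw (-b) v * ∫⁻ u, pw (-a) (r - u) * pw (b - a) u * pw (b - 1) (u - v) *
            pw (a - 1) (t - r) := by
          congr 1 with r
          rw [lintegral_mul_const' _ _ (pw_ne_top _ _), ← ker_eq_lintegral_kerDeriv hab, ker,
            mul_assoc, lintegral_mul_const' _ _ (pw_ne_top _ _)]
      _ = pw (-b) v * ∫⁻ u, ∫⁻ r, pw (-a) (r - u) * pw (b - a) u * pw (b - 1) (u - v) *
            pw (a - 1) (t - r) := by
          rw [lintegral_const_mul' _ _ (pw_ne_top _ _), lintegral_lintegral_swap (by fun_prop)]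
      _ = _ := by
          rw [← lintegral_const_mul' _ _ (pw_ne_top _ _)]
          congr 1 with u
          have : ∀ r, pw (-a) (r - u) * pw (b - a) u * pw (b - 1) (u - v) * pw (a - 1) (t - r) =
              pw (b - a) u * pw (b - 1) (u - v) * (pw (-a) (r - u) * pw (a - 1) (t - r)) := by
            intro r; ring
          simp_rw [this]
          rw [lintegral_const_mul _ (by fun_prop), lintegral_pw_mul_pw_compl' ha ha1]
          ring
  refine ae_eq_of_primitive_eq (by fun_prop) (by fun_prop) (fun t _ => ?_) (fun t _ => hprim t)
  rw [hprim]
  simp_rw [mul_assoc]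
  have hle := lintegral_pw_mul_pw_mul_zero_le (sub_pos.2 hab).le hb v t
  simp_rw [mul_assoc] at hle
  rw [lintegral_const_mul' _ _ (ebeta_ne_top _ _), lintegral_const_mul' _ _ (pw_ne_top _ _)]
  refine ENNReal.mul_ne_top (ebeta_ne_top _ _) (ENNReal.mul_ne_top (pw_ne_top _ _)
    (ne_top_of_le_ne_top ?_ hle))
  finiteness [pw_ne_top (b - a) t, pw_ne_top b (t - v), ebeta_ne_top b 1]

/-- The unnormalised fractional integral that occurs in the explicit solution. -/
noncomputable def solAux (a b s : ℝ) : ℝ≥0∞ :=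
  ∫⁻ x, pw (a - b) x * pw (-b) (1 - x) * pw (a - 1) (x - s)

@[fun_prop]
lemma measurable_solAux (a b : ℝ) : Measurable (solAux a b) :=
  Measurable.lintegral_prod_right' (f := fun p : ℝ × ℝ =>
    pw (a - b) p.2 * pw (-b) (1 - p.2) * pw (a - 1) (p.2 - p.1)) (by fun_prop)

/-- This explains the shape of `solAux`. By `lintegral_kerDeriv_mul_pw` its factor `(x-s)^{a-1}`
becomes `x^{b-a}(x-v)^{b-1}` up to constants; the weight `x^{a-b}` cancels the first power, and
`(1-x)^{-b}` is complementary to the second, so only `v^{-b}` survives. -/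
lemma lintegral_kerDeriv_mul_solAux {a b : ℝ} (ha : 0 < a) (hab : a < b) (hb1 : b < 1) (v : ℝ) :
    ∫⁻ s, kerDeriv a b s v * solAux a b s =
      ebeta a (1 - a) * ebeta b (1 - b) * (pw (-b) v * pw 0 (1 - v)) := by
  have hb : 0 < b := ha.trans hab
  rcases le_or_gt v 0 with hv | hv
  · simp [kerDeriv_of_nonpos hv, pw_of_nonpos hv]
  calc ∫⁻ s, kerDeriv a b s v * solAux a b s
      = ∫⁻ s, ∫⁻ x, pw (a - b) x * pw (-b) (1 - x) *
          (kerDeriv a b s v * pw (a - 1) (x - s)) := by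
        congr 1 with s
        rw [solAux, ← lintegral_const_mul _ (by fun_prop)]
        congr 1 with x
        ring
    _ = ∫⁻ x, ∫⁻ s, pw (a - b) x * pw (-b) (1 - x) *
          (kerDeriv a b s v * pw (a - 1) (x - s)) := lintegral_lintegral_swap (by fun_prop)
    _ = ∫⁻ x, ebeta a (1 - a) * pw (-b) v * (pw (b - 1) (x - v) * pw (-b) (1 - x)) := by
        refine lintegral_congr_ae ?_
        filter_upwards [lintegral_kerDeriv_mul_pw ha (hab.trans hb1) hab v 1] with x hx
        rw [lintegral_const_mul _ (by fun_prop)]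
        rcases le_or_gt 1 x with h1 | h1
        · simp [pw_of_nonpos (sub_nonpos.2 h1)]
        rcases le_or_gt x v with h2 | h2
        · rw [hx h1]
          simp [pw_of_nonpos (sub_nonpos.2 h2)]
        rw [hx h1]
        have := pw_neg_mul_self (α := b - a) (hv.trans h2)
        rw [show -(b - a) = a - b by ring] at this
        calc _ = (pw (a - b) x * pw (b - a) x) * (ebeta a (1 - a) * pw (-b) v *
              (pw (b - 1) (x - v) * pw (-b) (1 - x))) := by ring
          _ = _ := by rw [this, one_mul]
    _ = _ := by
        rw [lintegral_const_mul _ (by fun_prop), lintegral_pw_mul_pw_compl hb hb1]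
        ring

/-- Scaling `v` by `u`: the kernel is homogeneous of degree `b-2a-1`, and `v^{-b}` and `dv`
contribute `-b` and `1`. -/
lemma lintegral_kerDeriv_mul_pw_neg {a b u : ℝ} (hu : 0 < u) :
    ∫⁻ v, kerDeriv a b u v * pw (-b) v =
      pw (-2 * a) u * ∫⁻ v, kerDeriv a b 1 v * pw (-b) v := by
  rw [lintegral_affine _ 0 hu]
  have : ∀ v, kerDeriv a b u (0 + u * v) * pw (-b) (0 + u * v) =
      (pw (2 * (b - a) - b - 1) u * pw (-b) u) * (kerDeriv a b 1 v * pw (-b) v) := by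
    intro v
    have := kerDeriv_smul (a := a) (b := b) hu 1 v
    rw [mul_one] at this
    rw [zero_add, this, pw_mul hu]
    ring
  simp_rw [this]
  rw [lintegral_const_mul _ (by fun_prop), ← mul_assoc, ← pw_add,
    show -2 * a = 1 + (2 * (b - a) - b - 1 + -b) by ring, pw_add 1, pw_of_pos (α := 1) hu,
    Real.rpow_one]

/-- The constant comes from computing `∫ ker a b 1 v * v^{-b} dv` twice. As a primitive in the first
variable it is the unknown constant times `∫₀¹ r^{-2a} dr`; from the definition of `ker` it is a
product of two beta integrals, where `v^{-2b}` is integrable because `b < 1/2`. -/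
lemma lintegral_kerDeriv_one {a b : ℝ} (ha : 0 < a) (hab : a < b) (hb1 : b < 1 / 2) :
    (∫⁻ v, kerDeriv a b 1 v * pw (-b) v) * ebeta (1 - 2 * a) 1 =
      ebeta (1 - 2 * b) b * ebeta (1 - a) (1 - a) := by
  have h1 : ∫⁻ v, ker a b 1 v * pw (-b) v =
      (∫⁻ v, kerDeriv a b 1 v * pw (-b) v) * ebeta (1 - 2 * a) 1 := by
    simp_rw [ker_eq_lintegral_kerDeriv hab, ← lintegral_mul_const' _ _ (pw_ne_top _ _)]
    rw [lintegral_lintegral_swap (by fun_prop), ← lintegral_pw_mul_pw_one (by linarith) one_pos,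
      ← lintegral_const_mul _ (by fun_prop)]
    congr 1 with r
    have e : ∀ v, kerDeriv a b r v * pw 0 (1 - r) * pw (-b) v =
        pw 0 (1 - r) * (kerDeriv a b r v * pw (-b) v) := by intro v; ring
    simp_rw [e]
    rw [lintegral_const_mul _ (by fun_prop)]
    rcases le_or_gt r 0 with hr | hr
    · have : ∀ v, kerDeriv a b r v = 0 := by
        intro v
        rcases le_or_gt v 0 with hv | hv
        · exact kerDeriv_of_nonpos hv
        · exact kerDeriv_of_le (by linarith)
      simp [this, pw_of_nonpos hr]
    rw [lintegral_kerDeriv_mul_pw_neg hr, show 1 - 2 * a - 1 = -2 * a by ring,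
      show (1 : ℝ) - 1 = 0 by ring]
    ring
  rw [← h1]
  calc ∫⁻ v, ker a b 1 v * pw (-b) v
      = ∫⁻ v, ∫⁻ u, pw (-a) (1 - u) * pw (b - a) u *
          (pw (1 - 2 * b - 1) (v - 0) * pw (b - 1) (u - v)) := by
        congr 1 with v
        rw [ker, show ∀ p q : ℝ≥0∞, p * q * p = (p * p) * q by intros; ring, ← pw_add,
          ← lintegral_const_mul _ (by fun_prop)]
        congr 1 with u
        rw [show -b + -b = 1 - 2 * b - 1 by ring, sub_zero]
        ring
    _ = ∫⁻ u, ∫⁻ v, pw (-a) (1 - u) * pw (b - a) u *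
          (pw (1 - 2 * b - 1) (v - 0) * pw (b - 1) (u - v)) :=
        lintegral_lintegral_swap (by fun_prop)
    _ = ∫⁻ u, ebeta (1 - 2 * b) b * (pw (1 - a - 1) u * pw (1 - a - 1) (1 - u)) := by
        congr 1 with u
        rw [lintegral_const_mul _ (by fun_prop), lintegral_pw_mul_pw (by linarith) (by linarith),
          show 1 - a - 1 = (b - a) + (1 - 2 * b + b - 1) by ring, pw_add, sub_zero,
          show (b - a) + (1 - 2 * b + b - 1) = -a by ring]
        ring
    _ = _ := by
        rw [lintegral_const_mul _ (by fun_prop),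
          lintegral_pw_mul_pw_one (by linarith) (by linarith)]

/-- The explicit solution solves the equation, in `ℝ≥0∞`. -/
lemma lintegral_solAux_mul_covKer {a b u : ℝ} (ha : 0 < a) (hab : a < b) (hb1 : b < 1 / 2)
    (hu : 0 < u) (hu1 : u ≤ 1) :
    (∫⁻ s, solAux a b s * covKer a b s u) * ebeta (1 - 2 * a) 1 =
      ebeta a (1 - a) * ebeta b (1 - b) * (ebeta (1 - 2 * b) b * ebeta (1 - a) (1 - a)) *
        pw (-2 * a) u := by
  have : ∫⁻ s, solAux a b s * covKer a b s u =
      ebeta a (1 - a) * ebeta b (1 - b) * ∫⁻ v, kerDeriv a b u v * pw (-b) v := by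
    calc ∫⁻ s, solAux a b s * covKer a b s u
        = ∫⁻ s, ∫⁻ v, kerDeriv a b u v * (kerDeriv a b s v * solAux a b s) := by
          congr 1 with s
          rw [covKer, ← lintegral_const_mul _ (by fun_prop)]
          congr 1 with v
          ring
      _ = ∫⁻ v, ∫⁻ s, kerDeriv a b u v * (kerDeriv a b s v * solAux a b s) :=
          lintegral_lintegral_swap (by fun_prop)
      _ = _ := by
          rw [← lintegral_const_mul _ (by fun_prop)]
          congr 1 with v
          rw [lintegral_const_mul _ (by fun_prop),
            lintegral_kerDeriv_mul_solAux ha hab (by linarith)]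
          rcases le_or_gt u v with h | h
          · simp [kerDeriv_of_le h]
          rw [pw_zero_of_pos (by linarith)]
          ring
  rw [this, lintegral_kerDeriv_mul_pw_neg hu, ← lintegral_kerDeriv_one ha hab hb1]
  ring

/-! ### Injectivity of the Volterra operator, of its adjoint and of their product. -/

lemma exists_mem_Ioo_of_ae {p : ℝ → Prop} {x y : ℝ} (hxy : x < y) (h : ∀ᵐ t, p t) :
    ∃ t ∈ Ioo x y, p t := by
  by_contra! hcon
  have : volume (Ioo x y) = 0 := measure_mono_null (fun t ht => hcon t ht) (ae_iff.1 h)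
  simp only [Real.volume_Ioo, ENNReal.ofReal_eq_zero] at this
  linarith

/-- Injectivity of the Volterra operator with kernel `kerDeriv u v` acting in `v`. -/
lemma ae_eq_of_lintegral_kerDeriv_eq_left {a b : ℝ} (ha : 0 < a) (ha1 : a < 1) (hab : a < b)
    (hb1 : b < 1) {f g : ℝ → ℝ≥0∞} (hf : Measurable f) (hg : Measurable g) {R : ℝ} (hR : R ≤ 1)
    (hfin : ∀ᵐ u, 0 < u → u < R → ∫⁻ v, kerDeriv a b u v * f v ≠ ∞)
    (heq : ∀ᵐ u, 0 < u → u < R →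
      ∫⁻ v, kerDeriv a b u v * f v = ∫⁻ v, kerDeriv a b u v * g v) :
    ∀ᵐ v, 0 < v → v < R → f v = g v := by
  have hb : 0 < b := ha.trans hab
  have hc : 0 < b - a := sub_pos.2 hab
  -- Choose `u` in `(t, R)` at which the integral is finite. For `0 < v < t` one has `0 < u - v ≤
  -- 1`, so the singular factor is at least `1` and the lower bound on the kernel controls `∫_{v<t}
  -- v^{-b} f`.
  have hf1 : ∀ t < R, ∫⁻ v, pw (-b) v * f v * pw 0 (t - v) ≠ ∞ := by
    intro t ht
    rcases le_or_gt t 0 with ht0 | ht0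
    · have : ∀ v, pw (-b) v * f v * pw 0 (t - v) = 0 := by
        intro v
        rcases le_or_gt v 0 with hv | hv
        · simp [pw_of_nonpos hv]
        · simp [pw_of_nonpos (show t - v ≤ 0 by linarith)]
      simp [this]
    obtain ⟨u, hu, hu'⟩ := exists_mem_Ioo_of_ae ht hfin
    have hu0 := ht0.trans hu.1
    set A := ENNReal.ofReal (b - a) * ebeta (b + (b - a)) (1 - a) * pw (b - a) u with hA
    have hA0 : A ≠ 0 := by
      refine mul_ne_zero (mul_ne_zero (by simpa using hab)
        (ebeta_ne_zero (by linarith) (by linarith))) (pw_ne_zero hu0)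
    have hAt : A ≠ ∞ := by
      finiteness [ebeta_ne_top (b + (b - a)) (1 - a), pw_ne_top (b - a) u]
    have hle : A * ∫⁻ v, pw (-b) v * f v * pw 0 (t - v) ≤ ∫⁻ v, kerDeriv a b u v * f v := by
      rw [← lintegral_const_mul' _ _ hAt]
      refine lintegral_mono fun v => ?_
      rcases le_or_gt v 0 with hv | hv
      · simp [pw_of_nonpos hv]
      rcases le_or_gt t v with hv1 | hv1
      · simp [pw_of_nonpos (sub_nonpos.2 hv1)]
      have h1 : 1 ≤ pw (b - a - 1) (u - v) :=
        one_le_pw (by linarith) (by linarith [hu.1]) (by linarith [hu.2])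
      calc A * (pw (-b) v * f v * pw 0 (t - v))
          = A * pw (-b) v * f v * pw 0 (t - v) := by ring
        _ ≤ A * pw (-b) v * f v * pw (b - a - 1) (u - v) := by
            gcongr; exact (pw_zero_le_one _).trans h1
        _ = (ENNReal.ofReal (b - a) * ebeta (b + (b - a)) (1 - a)) *
            (pw (-b) v * pw (b - a) u * pw (b - a - 1) (u - v)) * f v := by rw [hA]; ring
        _ ≤ _ := by gcongr; exact le_kerDeriv ha1 hab hb u v
    intro htop
    rw [htop, ENNReal.mul_top hA0, top_le_iff] at hle
    exact hu' hu0 hu.2 hle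
  -- The primitive of the image is an Abel operator of order `1-a`, then the weight `u^{b-a}`, then
  -- an Abel operator of order `b`. They are removed one at a time, the outer one first.
  have hker : ∀ {f : ℝ → ℝ≥0∞}, Measurable f → ∀ t,
      ∫⁻ u, pw (b - a) u * (∫⁻ v, pw (-b) v * f v * pw (b - 1) (u - v)) * pw (1 - a - 1) (t - u) =
        ∫⁻ u, (∫⁻ v, kerDeriv a b u v * f v) * pw 0 (t - u) := by
    intro f hf t
    have e1 : ∫⁻ u, (∫⁻ v, kerDeriv a b u v * f v) * pw 0 (t - u) = ∫⁻ v, ker a b t v * f v := by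
      simp_rw [← lintegral_mul_const' _ _ (pw_ne_top _ _)]
      rw [lintegral_lintegral_swap (by fun_prop)]
      congr 1 with v
      rw [ker_eq_lintegral_kerDeriv hab, ← lintegral_mul_const _ (by fun_prop)]
      congr 1 with u
      ring
    have e2 : ∀ v, ker a b t v * f v = ∫⁻ u, pw (b - a) u *
        (pw (-b) v * f v * pw (b - 1) (u - v)) * pw (1 - a - 1) (t - u) := by
      intro v
      rw [ker, mul_right_comm, ← lintegral_const_mul _ (by fun_prop)]
      congr 1 with u
      rw [show 1 - a - 1 = -a by ring]
      ring
    rw [e1]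
    simp_rw [e2]
    rw [lintegral_lintegral_swap (by fun_prop)]
    congr 1 with u
    rw [lintegral_mul_const' _ _ (pw_ne_top _ _), lintegral_const_mul' _ _ (pw_ne_top _ _)]
  have hstep := ae_eq_of_abel_eq (α := 1 - a) (by linarith) (by linarith) (R := R)
    (f := fun u => pw (b - a) u * ∫⁻ v, pw (-b) v * f v * pw (b - 1) (u - v))
    (g := fun u => pw (b - a) u * ∫⁻ v, pw (-b) v * g v * pw (b - 1) (u - v))
    (by fun_prop) (by fun_prop) ?_ ?_
  · have h2 := ae_eq_of_abel_eq hb hb1 (f := fun v => pw (-b) v * f v)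
      (g := fun v => pw (-b) v * g v) (R := R) (by fun_prop) (by fun_prop) hf1 ?_
    · filter_upwards [h2] with v hv h0 h1
      exact (ENNReal.mul_right_inj (pw_ne_zero h0) (pw_ne_top _ _)).1 (hv h1)
    · filter_upwards [hstep] with u hu huR
      rcases le_or_gt u 0 with h0 | h0
      · have (f : ℝ → ℝ≥0∞) (v : ℝ) : pw (-b) v * f v * pw (b - 1) (u - v) = 0 := by
          rcases le_or_gt v 0 with hv | hv
          · simp [pw_of_nonpos hv]
          · simp [pw_of_nonpos (show u - v ≤ 0 by linarith)]
        simp only [this]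
      · exact (ENNReal.mul_right_inj (pw_ne_zero h0) (pw_ne_top _ _)).1 (hu huR)
  · intro t ht
    have hle : ∫⁻ u, pw (b - a) u * (∫⁻ v, pw (-b) v * f v * pw (b - 1) (u - v)) * pw 0 (t - u) ≤
        pw (b - a) t * ebeta b 1 * pw b t * ∫⁻ v, pw (-b) v * f v * pw 0 (t - v) := by
      simp_rw [← lintegral_const_mul' _ _ (pw_ne_top _ _),
        ← lintegral_mul_const' _ _ (pw_ne_top _ _)]
      rw [lintegral_lintegral_swap (by fun_prop), ← lintegral_const_mul' _ _ (by
        finiteness [pw_ne_top (b - a) t, pw_ne_top b t, ebeta_ne_top b 1])]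
      refine lintegral_mono fun v => ?_
      rcases le_or_gt v 0 with hv | hv
      · simp [pw_of_nonpos hv]
      have e : ∀ u, pw (b - a) u * (pw (-b) v * f v * pw (b - 1) (u - v)) * pw 0 (t - u) =
          pw (-b) v * f v * (pw (b - a) u * pw (b - 1) (u - v) * pw 0 (t - u)) := by
        intro u; ring
      simp_rw [e]
      rw [lintegral_const_mul _ (by fun_prop)]
      calc _ ≤ pw (-b) v * f v * (pw (b - a) t * (ebeta b 1 * pw b (t - v))) := by
            gcongr; exact lintegral_pw_mul_pw_mul_zero_le hc.le hb v t
        _ = pw (-b) v * f v * (pw (b - a) t * (ebeta b 1 * (pw b (t - v) * pw 0 (t - v)))) := by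
            rw [← pw_add, add_zero]
        _ ≤ pw (-b) v * f v * (pw (b - a) t * (ebeta b 1 * (pw b t * pw 0 (t - v)))) := by
            gcongr; exact pw_le_pw hb.le (by linarith)
        _ = _ := by ring
    refine ne_top_of_le_ne_top (ENNReal.mul_ne_top ?_ (hf1 t ht)) hle
    finiteness [pw_ne_top (b - a) t, pw_ne_top b t, ebeta_ne_top b 1]
  · refine Filter.Eventually.of_forall fun t ht => ?_
    rw [hker hf, hker hg]
    refine lintegral_congr_ae ?_
    filter_upwards [heq] with u hu
    rcases le_or_gt u 0 with h0 | h0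
    · have : ∀ v, kerDeriv a b u v = 0 := by
        intro v
        rcases le_or_gt v 0 with hv | hv
        · exact kerDeriv_of_nonpos hv
        · exact kerDeriv_of_le (by linarith)
      simp [this]
    rcases le_or_gt t u with h1 | h1
    · simp [pw_of_nonpos (sub_nonpos.2 h1)]
    rw [hu h0 (h1.trans ht)]

/-- For `y < z` both sides are `(y^{-c} z^c - 1)/c`. The weight `z^c` thus turns a primitive of
`u^{-c-1}` into a primitive of `x^{c-1}`, which is how the weight between the two Abel operators is
absorbed. -/
lemma pw_mul_lintegral_eq {c : ℝ} (hc : 0 < c) {y : ℝ} (hy : 0 < y) (z : ℝ) :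
    pw c z * ∫⁻ u, pw (-c - 1) u * pw 0 (u - y) * pw 0 (z - u) =
      pw (-c) y * ∫⁻ x, pw (c - 1) x * pw 0 (x - y) * pw 0 (z - x) := by
  rcases le_or_gt z y with hzy | hzy
  · have : ∀ u, pw 0 (u - y) * pw 0 (z - u) = 0 := by
      intro u
      rcases le_or_gt u y with hu | hu
      · simp [pw_of_nonpos (sub_nonpos.2 hu)]
      · simp [pw_of_nonpos (show z - u ≤ 0 by linarith)]
    simp [mul_assoc, this]
  have hz := hy.trans hzy
  have hI : ∀ d : ℝ, d ≠ 0 → ∫⁻ x, pw (d - 1) x * pw 0 (x - y) * pw 0 (z - x) =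
      ENNReal.ofReal (z ^ d / d - y ^ d / d) := by
    intro d hd
    rw [lintegral_mul_pw_mul_pw (g := fun x => x ^ (d - 1)), setLIntegral_deriv hzy.le
      (F := fun x => x ^ d / d)]
    · exact (ContinuousOn.rpow_const continuousOn_id
        fun x hx => Or.inl (hy.trans_le hx.1).ne').div_const _
    · intro x hx
      have := (Real.hasDerivAt_rpow_const (p := d) (Or.inl (hy.trans hx.1).ne')).div_const d
      rwa [mul_div_cancel_left₀ _ hd] at this
    · exact fun x hx => Real.rpow_nonneg (hy.trans hx.1).le _
    · intro x hx
      rw [pw_zero_of_pos (sub_pos.2 hx.1), pw_zero_of_pos (sub_pos.2 hx.2), mul_one, mul_one,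
        pw_of_pos (hy.trans hx.1)]
  rw [hI _ (neg_ne_zero.2 hc.ne'), hI _ hc.ne', pw_of_pos hz, pw_of_pos hy,
    ← ENNReal.ofReal_mul (Real.rpow_nonneg hz.le _), ← ENNReal.ofReal_mul (Real.rpow_nonneg hy.le _),
    Real.rpow_neg hz.le, Real.rpow_neg hy.le]
  have h1 := (Real.rpow_pos_of_pos hz c).ne'
  have h2 := (Real.rpow_pos_of_pos hy c).ne'
  congr 1
  field_simp
  ring

/-- The kernel, in the variable `v`, that inverts the Volterra operator from the right up to a
fractional integral. -/
noncomputable def invKer (b c y v : ℝ) : ℝ≥0∞ :=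
  pw b v * ∫⁻ u, pw (-c - 1) u * pw 0 (u - y) * pw (-b) (v - u)

@[fun_prop]
lemma measurable_invKer (b c y : ℝ) : Measurable (invKer b c y) := by
  have : Measurable fun v => ∫⁻ u, pw (-c - 1) u * pw 0 (u - y) * pw (-b) (v - u) :=
    Measurable.lintegral_prod_right' (f := fun p : ℝ × ℝ =>
      pw (-c - 1) p.2 * pw 0 (p.2 - y) * pw (-b) (p.1 - p.2)) (by fun_prop)
  unfold invKer
  fun_prop

lemma pw_neg_mul_invKer {b c y : ℝ} (hy : 0 < y) (v : ℝ) :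
    pw (-b) v * invKer b c y v = ∫⁻ u, pw (-c - 1) u * pw 0 (u - y) * pw (-b) (v - u) := by
  rcases le_or_gt v 0 with hv | hv
  · have : ∀ u, pw 0 (u - y) * pw (-b) (v - u) = 0 := by
      intro u
      rcases le_or_gt u y with hu | hu
      · simp [pw_of_nonpos (sub_nonpos.2 hu)]
      · simp [pw_of_nonpos (show v - u ≤ 0 by linarith)]
    simp [pw_of_nonpos hv, mul_assoc, this]
  · rw [invKer, ← mul_assoc, pw_neg_mul_self hv, one_mul]

/-- Apart from its prefactor, `invKer` is the fractional integral of order `1-b` of `u^{-c-1}` on `u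
> y`, with `c = b-a`. The inner Abel operator of order `b` completes it to a primitive,
`pw_mul_lintegral_eq` absorbs the weight, and differentiating the remaining operator of order `1-a`
applied to a primitive leaves that operator applied to `x^{c-1}` on `x > y`. -/
lemma lintegral_kerDeriv_mul_invKer {a b : ℝ} (ha : 0 < a) (ha1 : a < 1) (hab : a < b)
    (hb : 0 < b) (hb1 : b < 1) {y : ℝ} (hy : 0 < y) (R : ℝ) :
    ∀ᵐ s, s < R → ∫⁻ v, kerDeriv a b s v * invKer b (b - a) y v =
      ebeta b (1 - b) * pw (-(b - a)) y *
        ∫⁻ x, pw (b - a - 1) x * pw 0 (x - y) * pw (-a) (s - x) := by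
  have hc : 0 < b - a := sub_pos.2 hab
  have hrhs : ∀ t, ∫⁻ s, (ebeta b (1 - b) * pw (-(b - a)) y *
        ∫⁻ x, pw (b - a - 1) x * pw 0 (x - y) * pw (-a) (s - x)) * pw 0 (t - s) =
      ebeta b (1 - b) * pw (-(b - a)) y *
        ∫⁻ x, pw (b - a - 1) x * pw 0 (x - y) * ∫⁻ s, pw 0 (s - x) * pw (-a) (t - s) := by
    intro t
    simp_rw [mul_assoc (ebeta b (1 - b) * pw (-(b - a)) y)]
    rw [lintegral_const_mul _ (by fun_prop)]
    congr 1
    simp_rw [← lintegral_mul_const' _ _ (pw_ne_top _ _)]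
    rw [lintegral_lintegral_swap (by fun_prop)]
    congr 1 with x
    have := lintegral_pw_mul_pw_zero_comm (α := 1 - a) (by linarith) x t
    rw [show 1 - a - 1 = -a by ring] at this
    rw [← this, ← lintegral_const_mul _ (by fun_prop)]
    congr 1 with s
    ring
  -- The explicit right-hand side is taken as the first function, because finiteness of primitives
  -- has to be checked for that one only.
  refine ae_eq_of_primitive_eq (by fun_prop) (by fun_prop) ?_ ?_ |>.mono
    fun s hs hsR => (hs hsR).symm
  · intro t _
    rw [hrhs]
    have hle : ∫⁻ x, pw (b - a - 1) x * pw 0 (x - y) * ∫⁻ s, pw 0 (s - x) * pw (-a) (t - s) ≤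
        pw (b - a - 1) y * (ebeta 1 (1 - a) * (ebeta 1 (2 - a) * pw (2 - a) (t - y))) := by
      have e : ∀ x, ∫⁻ s, pw 0 (s - x) * pw (-a) (t - s) =
          ebeta 1 (1 - a) * pw (1 - a) (t - x) := by
        intro x
        have := lintegral_pw_mul_pw one_pos (sub_pos.2 ha1) x t
        rwa [show (1 : ℝ) - 1 = 0 by ring, show 1 - a - 1 = -a by ring,
          show 1 + (1 - a) - 1 = 1 - a by ring] at this
      have e2 := lintegral_pw_mul_pw one_pos (show 0 < 2 - a by linarith) y t
      rw [show (1 : ℝ) - 1 = 0 by ring, show 2 - a - 1 = 1 - a by ring,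
          show 1 + (2 - a) - 1 = 2 - a by ring] at e2
      simp_rw [e]
      rw [← e2, ← lintegral_const_mul' _ _ (ebeta_ne_top _ _), ← lintegral_const_mul' _ _
        (pw_ne_top _ _)]
      refine lintegral_mono fun x => ?_
      rcases le_or_gt x y with hx | hx
      · simp [pw_of_nonpos (sub_nonpos.2 hx)]
      calc _ ≤ pw (b - a - 1) y * pw 0 (x - y) * (ebeta 1 (1 - a) * pw (1 - a) (t - x)) := by
            gcongr; exact pw_le_pw_of_nonpos (by linarith) hy hx.le
        _ = _ := by ring
    refine ENNReal.mul_ne_top ?_ (ne_top_of_le_ne_top ?_ hle)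
    · finiteness [pw_ne_top (-(b - a)) y, ebeta_ne_top b (1 - b)]
    · finiteness [pw_ne_top (b - a - 1) y, ebeta_ne_top 1 (1 - a), ebeta_ne_top 1 (2 - a),
        pw_ne_top (2 - a) (t - y)]
  · intro t _
    rw [hrhs]
    symm
    calc ∫⁻ s, (∫⁻ v, kerDeriv a b s v * invKer b (b - a) y v) * pw 0 (t - s)
        = ∫⁻ v, ker a b t v * invKer b (b - a) y v := by
          simp_rw [← lintegral_mul_const' _ _ (pw_ne_top _ _)]
          rw [lintegral_lintegral_swap (by fun_prop)]
          congr 1 with v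
          rw [ker_eq_lintegral_kerDeriv hab, ← lintegral_mul_const _ (by fun_prop)]
          congr 1 with s
          ring
      _ = ∫⁻ v, ∫⁻ z, pw (-a) (t - z) * pw (b - a) z * ((∫⁻ u, pw (-(b - a) - 1) u *
            pw 0 (u - y) * pw (-b) (v - u)) * pw (b - 1) (z - v)) := by
          congr 1 with v
          rw [ker, mul_right_comm, pw_neg_mul_invKer hy, ← lintegral_const_mul _ (by fun_prop)]
          congr 1 with z
          ring
      _ = ∫⁻ z, ∫⁻ v, pw (-a) (t - z) * pw (b - a) z * ((∫⁻ u, pw (-(b - a) - 1) u *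
            pw 0 (u - y) * pw (-b) (v - u)) * pw (b - 1) (z - v)) :=
          lintegral_lintegral_swap (by fun_prop)
      _ = ∫⁻ z, pw (-a) (t - z) * (ebeta b (1 - b) * pw (-(b - a)) y *
            ∫⁻ x, pw (b - a - 1) x * pw 0 (x - y) * pw 0 (z - x)) := by
          congr 1 with z
          rw [lintegral_const_mul _ (by fun_prop), mul_assoc]
          congr 1
          have e : ∫⁻ v, (∫⁻ u, pw (-(b - a) - 1) u * pw 0 (u - y) * pw (-b) (v - u)) *
              pw (b - 1) (z - v) = ebeta b (1 - b) * ∫⁻ u, pw (-(b - a) - 1) u * pw 0 (u - y) *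
                pw 0 (z - u) := by
            simp_rw [← lintegral_mul_const' _ _ (pw_ne_top _ _)]
            rw [lintegral_lintegral_swap (by fun_prop), ← lintegral_const_mul _ (by fun_prop)]
            congr 1 with u
            simp_rw [mul_assoc]
            rw [lintegral_const_mul' _ _ (pw_ne_top _ _), lintegral_const_mul' _ _ (pw_ne_top _ _),
              lintegral_pw_mul_pw_compl' hb hb1]
            ring
          rw [e, mul_left_comm, pw_mul_lintegral_eq hc hy]
          ring
      _ = _ := by
          have e : ∀ z, pw (-a) (t - z) * (ebeta b (1 - b) * pw (-(b - a)) y *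
              ∫⁻ x, pw (b - a - 1) x * pw 0 (x - y) * pw 0 (z - x)) =
              ebeta b (1 - b) * pw (-(b - a)) y * ∫⁻ x, pw (b - a - 1) x * pw 0 (x - y) *
                (pw 0 (z - x) * pw (-a) (t - z)) := by
            intro z
            rw [mul_left_comm, ← lintegral_const_mul' _ _ (pw_ne_top _ _)]
            congr 2 with x
            ring
          simp_rw [e]
          rw [lintegral_const_mul _ (by fun_prop), lintegral_lintegral_swap (by fun_prop)]
          congr 2 with x
          rw [lintegral_const_mul _ (by fun_prop)]

/-- Injectivity of the Volterra operator with kernel `kerDeriv s v` acting in `s`. -/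
lemma ae_eq_of_lintegral_kerDeriv_eq_right {a b : ℝ} (ha : 0 < a) (ha1 : a < 1) (hab : a < b)
    (hb1 : b < 1) {f g : ℝ → ℝ≥0∞} (hf : Measurable f) (hg : Measurable g)
    (hf0 : ∀ s, 1 ≤ s → f s = 0) (hg0 : ∀ s, 1 ≤ s → g s = 0)
    (hfin : ∀ᵐ v, 0 < v → v < 1 → ∫⁻ s, kerDeriv a b s v * f s ≠ ∞)
    (heq : ∀ᵐ v, 0 < v → v < 1 →
      ∫⁻ s, kerDeriv a b s v * f s = ∫⁻ s, kerDeriv a b s v * g s) :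
    ∀ᵐ s, 0 < s → f s = g s := by
  have hb : 0 < b := ha.trans hab
  have hc : 0 < b - a := sub_pos.2 hab
  have hvan : ∀ {f : ℝ → ℝ≥0∞}, (∀ s, 1 ≤ s → f s = 0) → ∀ v, 1 ≤ v →
      ∫⁻ s, kerDeriv a b s v * f s = 0 := by
    intro f hf0 v hv
    have : ∀ s, kerDeriv a b s v * f s = 0 := by
      intro s
      rcases le_or_gt s v with h | h
      · simp [kerDeriv_of_le h]
      · simp [hf0 s (hv.trans h.le)]
    simp [this]
  -- Here `v` is chosen in `(0, y)`; for `y < s < 1` the distance `s - v` is below `1`, so the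
  -- singular factor is again at least `1`.
  have hf1 : ∀ y, 0 < y → ∫⁻ s, f s * pw 0 (s - y) ≠ ∞ := by
    intro y hy
    rcases le_or_gt 1 y with hy1 | hy1
    · have : ∀ s, f s * pw 0 (s - y) = 0 := by
        intro s
        rcases le_or_gt s y with h | h
        · simp [pw_of_nonpos (sub_nonpos.2 h)]
        · simp [hf0 s (hy1.trans h.le)]
      simp [this]
    obtain ⟨v, hv, hv'⟩ := exists_mem_Ioo_of_ae hy hfin
    set A := ENNReal.ofReal (b - a) * ebeta (b + (b - a)) (1 - a) * (pw (-b) v * pw (b - a) v)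
      with hA
    have hA0 : A ≠ 0 := by
      refine mul_ne_zero (mul_ne_zero (by simpa using hab)
        (ebeta_ne_zero (by linarith) (by linarith))) (mul_ne_zero (pw_ne_zero hv.1)
        (pw_ne_zero hv.1))
    have hAt : A ≠ ∞ := by
      finiteness [ebeta_ne_top (b + (b - a)) (1 - a), pw_ne_top (b - a) v, pw_ne_top (-b) v]
    have hle : A * ∫⁻ s, f s * pw 0 (s - y) ≤ ∫⁻ s, kerDeriv a b s v * f s := by
      rw [← lintegral_const_mul' _ _ hAt]
      refine lintegral_mono fun s => ?_
      rcases le_or_gt 1 s with hs | hs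
      · simp [hf0 s hs]
      rcases le_or_gt s y with hs1 | hs1
      · simp [pw_of_nonpos (sub_nonpos.2 hs1)]
      have h1 : 1 ≤ pw (b - a - 1) (s - v) :=
        one_le_pw (by linarith) (by linarith [hv.2]) (by linarith [hv.1])
      calc A * (f s * pw 0 (s - y))
          = ENNReal.ofReal (b - a) * ebeta (b + (b - a)) (1 - a) *
            (pw (-b) v * pw (b - a) v * pw 0 (s - y)) * f s := by rw [hA]; ring
        _ ≤ ENNReal.ofReal (b - a) * ebeta (b + (b - a)) (1 - a) *
            (pw (-b) v * pw (b - a) s * pw (b - a - 1) (s - v)) * f s := by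
            gcongr
            · exact pw_le_pw hc.le (by linarith [hv.2])
            · exact (pw_zero_le_one _).trans h1
        _ ≤ _ := by gcongr; exact le_kerDeriv ha1 hab hb s v
    intro htop
    rw [htop, ENNReal.mul_top hA0, top_le_iff] at hle
    exact hv' hv.1 (hv.2.trans hy1) hle
  -- Pairing the image with `invKer` and moving the operator onto `invKer` produces a tail integral
  -- over `x > y`.
  have hfinal : ∀ {f : ℝ → ℝ≥0∞}, Measurable f → (∀ s, 1 ≤ s → f s = 0) → ∀ y, 0 < y →
      ∫⁻ v, invKer b (b - a) y v * ∫⁻ s, kerDeriv a b s v * f s =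
        ebeta b (1 - b) * pw (-(b - a)) y *
          ∫⁻ x, pw (b - a - 1) x * (∫⁻ s, f s * pw (1 - a - 1) (s - x)) * pw 0 (x - y) := by
    intro f hf hf0 y hy
    calc ∫⁻ v, invKer b (b - a) y v * ∫⁻ s, kerDeriv a b s v * f s
        = ∫⁻ v, ∫⁻ s, f s * (kerDeriv a b s v * invKer b (b - a) y v) := by
          congr 1 with v
          rw [← lintegral_const_mul _ (by fun_prop)]
          congr 1 with s
          ring
      _ = ∫⁻ s, f s * ∫⁻ v, kerDeriv a b s v * invKer b (b - a) y v := by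
          rw [lintegral_lintegral_swap (by fun_prop)]
          congr 1 with s
          rw [lintegral_const_mul _ (by fun_prop)]
      _ = ∫⁻ s, ebeta b (1 - b) * pw (-(b - a)) y *
            ∫⁻ x, f s * (pw (b - a - 1) x * pw 0 (x - y) * pw (-a) (s - x)) := by
          refine lintegral_congr_ae ?_
          filter_upwards [lintegral_kerDeriv_mul_invKer ha ha1 hab hb hb1 hy 1] with s hs
          rcases le_or_gt 1 s with h | h
          · simp [hf0 s h]
          rw [hs h, lintegral_const_mul _ (by fun_prop)]
          ring
      _ = _ := by
          rw [lintegral_const_mul _ (by fun_prop), lintegral_lintegral_swap (by fun_prop)]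
          congr 2 with x
          rw [mul_right_comm, ← lintegral_const_mul _ (by fun_prop)]
          congr 1 with s
          rw [show 1 - a - 1 = -a by ring]
          ring
  -- Tail integrals for all `y > 0` determine the integrand; dividing by `x^{b-a-1}` leaves a
  -- right-sided Abel equation of order `1-a`.
  have hstep := ae_eq_of_primitive_eq_right (R := 0)
    (f := fun x => pw (b - a - 1) x * ∫⁻ s, f s * pw (1 - a - 1) (s - x))
    (g := fun x => pw (b - a - 1) x * ∫⁻ s, g s * pw (1 - a - 1) (s - x))
    (by fun_prop) (by fun_prop) ?_ ?_
  · refine ae_eq_of_abel_eq_right (α := 1 - a) (by linarith) (by linarith) hf hg hf1 ?_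
    filter_upwards [hstep] with x hx h0
    exact (ENNReal.mul_right_inj (pw_ne_zero h0) (pw_ne_top _ _)).1 (hx h0)
  · intro y hy
    have hle : ∫⁻ x, pw (b - a - 1) x * (∫⁻ s, f s * pw (1 - a - 1) (s - x)) * pw 0 (x - y) ≤
        pw (b - a - 1) y * ebeta 1 (1 - a) * ∫⁻ s, f s * pw 0 (s - y) := by
      simp_rw [← lintegral_const_mul' _ _ (pw_ne_top _ _),
        ← lintegral_mul_const' _ _ (pw_ne_top _ _)]
      rw [lintegral_lintegral_swap (by fun_prop), ← lintegral_const_mul' _ _ (by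
        finiteness [pw_ne_top (b - a - 1) y, ebeta_ne_top 1 (1 - a)])]
      refine lintegral_mono fun s => ?_
      rcases le_or_gt 1 s with hs | hs
      · simp [hf0 s hs]
      have e2 := lintegral_pw_mul_pw one_pos (sub_pos.2 ha1) y s
      rw [show (1 : ℝ) - 1 = 0 by ring, show 1 + (1 - a) - 1 = 1 - a by ring] at e2
      calc ∫⁻ x, pw (b - a - 1) x * (f s * pw (1 - a - 1) (s - x)) * pw 0 (x - y)
          ≤ ∫⁻ x, pw (b - a - 1) y * f s * (pw 0 (x - y) * pw (1 - a - 1) (s - x)) := by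
            refine lintegral_mono fun x => ?_
            rcases le_or_gt x y with hx | hx
            · simp [pw_of_nonpos (sub_nonpos.2 hx)]
            calc _ ≤ pw (b - a - 1) y * (f s * pw (1 - a - 1) (s - x)) * pw 0 (x - y) := by
                  gcongr; exact pw_le_pw_of_nonpos (by linarith) hy hx.le
              _ = _ := by ring
        _ = pw (b - a - 1) y * f s * (ebeta 1 (1 - a) * pw (1 - a) (s - y)) := by
            rw [lintegral_const_mul _ (by fun_prop), e2]
        _ = pw (b - a - 1) y * f s * (ebeta 1 (1 - a) * (pw (1 - a) (s - y) * pw 0 (s - y))) := by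
            rw [← pw_add, add_zero]
        _ ≤ pw (b - a - 1) y * f s * (ebeta 1 (1 - a) * (1 * pw 0 (s - y))) := by
            gcongr
            rw [← pw_one_right (1 - a)]
            exact pw_le_pw (by linarith) (by linarith)
        _ = _ := by ring
    refine ne_top_of_le_ne_top (ENNReal.mul_ne_top ?_ (hf1 y hy)) hle
    finiteness [pw_ne_top (b - a - 1) y, ebeta_ne_top 1 (1 - a)]
  · intro y hy
    refine (ENNReal.mul_right_inj (a := ebeta b (1 - b) * pw (-(b - a)) y)
      (mul_ne_zero (ebeta_ne_zero hb (by linarith)) (pw_ne_zero hy))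
      (ENNReal.mul_ne_top (ebeta_ne_top _ _) (pw_ne_top _ _))).1 ?_
    rw [← hfinal hf hf0 y hy, ← hfinal hg hg0 y hy]
    refine lintegral_congr_ae ?_
    filter_upwards [heq] with v hv
    rcases le_or_gt v 0 with h0 | h0
    · simp [kerDeriv_of_nonpos h0]
    rcases le_or_gt 1 v with h1 | h1
    · rw [hvan hf0 v h1, hvan hg0 v h1]
    rw [hv h0 h1]

/-- Injectivity of the operator with kernel `covKer`. -/
lemma ae_eq_of_lintegral_covKer_eq {a b : ℝ} (ha : 0 < a) (ha1 : a < 1) (hab : a < b)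
    (hb1 : b < 1) {f g : ℝ → ℝ≥0∞} (hf : Measurable f) (hg : Measurable g)
    (hf0 : ∀ s, 1 ≤ s → f s = 0) (hg0 : ∀ s, 1 ≤ s → g s = 0)
    (hfin : ∀ᵐ u, 0 < u → u < 1 → ∫⁻ s, f s * covKer a b s u ≠ ∞)
    (heq : ∀ᵐ u, 0 < u → u < 1 → ∫⁻ s, f s * covKer a b s u = ∫⁻ s, g s * covKer a b s u) :
    ∀ᵐ s, 0 < s → f s = g s := by
  have hb := ha.trans hab
  have key : ∀ {f : ℝ → ℝ≥0∞}, Measurable f → ∀ u, ∫⁻ s, f s * covKer a b s u =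
      ∫⁻ v, kerDeriv a b u v * ∫⁻ s, kerDeriv a b s v * f s := by
    intro f hf u
    simp_rw [covKer, ← lintegral_const_mul' _ _ (kerDeriv_ne_top ha1 hab hb _ _)]
    have : ∀ s, f s * ∫⁻ v, kerDeriv a b s v * kerDeriv a b u v =
        ∫⁻ v, kerDeriv a b u v * (kerDeriv a b s v * f s) := by
      intro s
      rw [← lintegral_const_mul _ (by fun_prop)]
      congr 1 with v
      ring
    simp_rw [this]
    exact lintegral_lintegral_swap (by fun_prop)
  simp_rw [key hf, key hg] at hfin heq
  refine ae_eq_of_lintegral_kerDeriv_eq_right ha ha1 hab hb1 hf hg hf0 hg0 ?_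
    (ae_eq_of_lintegral_kerDeriv_eq_left ha ha1 hab hb1 (by fun_prop) (by fun_prop) le_rfl hfin heq)
  -- The inner integral is finite almost everywhere below any `u` at which the outer one is finite,
  -- since the kernel is positive there; such `u` exist arbitrarily close to `1`.
  have hn : ∀ n : ℕ, ∀ᵐ v, 0 < v → v < 1 - 1 / ((n : ℝ) + 2) →
      ∫⁻ s, kerDeriv a b s v * f s ≠ ∞ := by
    intro n
    have hn0 : (0 : ℝ) < 1 / ((n : ℝ) + 2) := by positivity
    have hn1 : 1 / ((n : ℝ) + 2) < 1 := by
      rw [div_lt_one (by positivity)]; linarith [(Nat.cast_nonneg n : (0 : ℝ) ≤ n)]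
    obtain ⟨u, hu, hu'⟩ := exists_mem_Ioo_of_ae
      (show 1 - 1 / ((n : ℝ) + 2) < 1 by linarith) hfin
    filter_upwards [ae_lt_top (by fun_prop) (hu' (by linarith [hu.1]) hu.2)] with v hv h0 h1 htop
    rw [htop, ENNReal.mul_top (kerDeriv_ne_zero ha1 hab hb h0 (h1.trans hu.1))] at hv
    exact lt_irrefl _ hv
  filter_upwards [ae_all_iff.2 hn] with v hv h0 h1
  obtain ⟨n, hn⟩ := exists_nat_one_div_lt (sub_pos.2 h1)
  refine hv n h0 ?_
  have : 1 / ((n : ℝ) + 2) ≤ 1 / ((n : ℝ) + 1) := by gcongr; norm_num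
  linarith

/-! ### The explicit solution as a real function. -/

lemma solAux_of_one_le {a b s : ℝ} (hs : 1 ≤ s) : solAux a b s = 0 := by
  have : ∀ x, pw (a - b) x * pw (-b) (1 - x) * pw (a - 1) (x - s) = 0 := by
    intro x
    rcases le_or_gt x s with hx | hx
    · simp [pw_of_nonpos (sub_nonpos.2 hx)]
    · simp [pw_of_nonpos (show 1 - x ≤ 0 by linarith)]
  simp [solAux, this]

lemma solAux_le {a b s : ℝ} (ha : 0 < a) (hab : a < b) (hb1 : b < 1) (hs : 0 < s) :
    solAux a b s ≤ pw (a - b) s * (ebeta a (1 - b) * pw (a - b) (1 - s)) := by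
  have h := lintegral_pw_mul_pw ha (sub_pos.2 hb1) s 1
  rw [show a + (1 - b) - 1 = a - b by ring] at h
  rw [← h, ← lintegral_const_mul' _ _ (pw_ne_top _ _)]
  refine lintegral_mono fun x => ?_
  rcases le_or_gt x s with hx | hx
  · simp [pw_of_nonpos (sub_nonpos.2 hx)]
  calc _ ≤ pw (a - b) s * pw (-b) (1 - x) * pw (a - 1) (x - s) := by
        gcongr; exact pw_le_pw_of_nonpos (by linarith) hs hx.le
    _ = _ := by rw [show 1 - b - 1 = -b by ring]; ring

lemma solAux_ne_top {a b s : ℝ} (ha : 0 < a) (hab : a < b) (hb1 : b < 1) (hs : 0 < s) :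
    solAux a b s ≠ ∞ := by
  refine ne_top_of_le_ne_top ?_ (solAux_le ha hab hb1 hs)
  finiteness [pw_ne_top (a - b) s, pw_ne_top (a - b) (1 - s), ebeta_ne_top a (1 - b)]

lemma solAux_ne_zero {a b s : ℝ} (hs : 0 < s) (hs1 : s < 1) : solAux a b s ≠ 0 := by
  intro h
  rw [solAux, lintegral_eq_zero_iff (by fun_prop)] at h
  obtain ⟨x, hx, hx0⟩ := exists_mem_Ioo_of_ae hs1 h
  exact mul_ne_zero (mul_ne_zero (pw_ne_zero (hs.trans hx.1)) (pw_ne_zero (sub_pos.2 hx.2)))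
    (pw_ne_zero (sub_pos.2 hx.1)) hx0

lemma covKer_of_nonpos {a b s u : ℝ} (hs : s ≤ 0) : covKer a b s u = 0 := by
  have : ∀ v, kerDeriv a b s v = 0 := by
    intro v
    rcases le_or_gt v 0 with hv | hv
    · exact kerDeriv_of_nonpos hv
    · exact kerDeriv_of_le (by linarith)
  simp [covKer, this]

lemma solution_eq {H₁ H₂ C s : ℝ} (hs : 0 < s) (hs1 : s ≤ 1) :
    solution H₁ H₂ C s = solConst H₁ H₂ C / Real.Gamma (H₁ - 1 / 2) * s ^ (1 / 2 - H₁) *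
      (solAux (H₁ - 1 / 2) (H₂ - 1 / 2) s).toReal := by
  have hint : ∫ t in s..1, t ^ (H₁ - H₂) * (1 - t) ^ (1 / 2 - H₂) *
      (t - s) ^ (H₁ - 1 / 2 - 1) = (solAux (H₁ - 1 / 2) (H₂ - 1 / 2) s).toReal := by
    rw [solAux, show H₁ - 1 / 2 - (H₂ - 1 / 2) = H₁ - H₂ by ring,
      show -(H₂ - 1 / 2) = 1 / 2 - H₂ by ring]
    have hind : ∫⁻ t, pw (H₁ - H₂) t * pw (1 / 2 - H₂) (1 - t) * pw (H₁ - 1 / 2 - 1) (t - s) =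
        ∫⁻ t in Ioo s 1,
          pw (H₁ - H₂) t * pw (1 / 2 - H₂) (1 - t) * pw (H₁ - 1 / 2 - 1) (t - s) := by
      rw [← lintegral_indicator measurableSet_Ioo]
      congr 1 with t
      by_cases ht : t ∈ Ioo s 1
      · rw [indicator_of_mem ht]
      · rw [indicator_of_notMem ht]
        rcases le_or_gt t s with h1 | h1
        · simp [pw_of_nonpos (sub_nonpos.2 h1)]
        · have h2 : 1 ≤ t := by by_contra! h2; exact ht ⟨h1, h2⟩
          simp [pw_of_nonpos (sub_nonpos.2 h2)]
    rw [hind, intervalIntegral.integral_of_le hs1, integral_Ioc_eq_integral_Ioo,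
      ← integral_toReal (by fun_prop) (Filter.Eventually.of_forall fun t => by
        finiteness [pw_ne_top (H₁ - H₂) t, pw_ne_top (1 / 2 - H₂) (1 - t),
          pw_ne_top (H₁ - 1 / 2 - 1) (t - s)])]
    refine setIntegral_congr_fun measurableSet_Ioo fun t ht => ?_
    simp only [ENNReal.toReal_mul]
    rw [toReal_pw (sub_pos.2 ht.1), toReal_pw (sub_pos.2 ht.2), toReal_pw (hs.trans ht.1)]
  rw [solution, fracIntegralRight, hint]
  ring

lemma kernelk₁_eq {H₁ H₂ s u : ℝ} (hH₁ : 1 / 2 < H₁) (hH₁₂ : H₁ < H₂) (hH₂ : H₂ < 1)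
    (hs : 0 < s) (hu : 0 < u) :
    kernelk₁ H₁ H₂ s u = u ^ (H₁ - 1 / 2) * betaH H₂ ^ 2 *
      (s ^ (H₁ - 1 / 2) * (covKer (H₁ - 1 / 2) (H₂ - 1 / 2) s u).toReal) := by
  rw [kernelk₁, kernelk_eq hH₁ hH₁₂ hH₂ hs hu]
  ring

lemma memLp_solution {H₁ H₂ : ℝ} (hH₁ : 1 / 2 < H₁) (hH₁₂ : H₁ < H₂) (hH₂ : H₂ < 1) (C : ℝ) :
    MemLp (solution H₁ H₂ C) 2 (volume.restrict (Ioc (0 : ℝ) 1)) := by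
  obtain ⟨a, rfl⟩ : ∃ a, H₁ = a + 1 / 2 := ⟨H₁ - 1 / 2, by ring⟩
  obtain ⟨b, rfl⟩ : ∃ b, H₂ = b + 1 / 2 := ⟨H₂ - 1 / 2, by ring⟩
  have ha : 0 < a := by linarith
  have hab : a < b := by linarith
  have hb1 : b < 1 / 2 := by linarith
  have hmeas : AEStronglyMeasurable (solution (a + 1 / 2) (b + 1 / 2) C)
      (volume.restrict (Ioc (0 : ℝ) 1)) := by
    refine AEStronglyMeasurable.congr (f := fun s =>
      solConst (a + 1 / 2) (b + 1 / 2) C / Real.Gamma a * s ^ (-a) * (solAux a b s).toReal)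
      (Measurable.aestronglyMeasurable (by fun_prop)) ?_
    refine (ae_restrict_iff' measurableSet_Ioc).2 (Filter.Eventually.of_forall fun s hs => ?_)
    rw [solution_eq hs.1 hs.2, add_sub_cancel_right, add_sub_cancel_right,
      show 1 / 2 - (a + 1 / 2) = -a by ring]
  rw [memLp_two_iff_integrable_sq hmeas]
  have hint : Integrable (fun s => (pw (-2 * a) s * solAux a b s ^ 2).toReal)
      (volume.restrict (Ioc (0 : ℝ) 1)) := by
    refine integrable_toReal_of_lintegral_ne_top (by fun_prop) ?_
    -- By `solAux_le` the square is dominated by `s^{-2b} (1-s)^{2(a-b)}`; both exponents exceed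
    -- `-1` because `0 < a < b < 1/2`.
    have hle : ∫⁻ s in Ioc (0 : ℝ) 1, pw (-2 * a) s * solAux a b s ^ 2 ≤
        ∫⁻ s, ebeta a (1 - b) ^ 2 *
          (pw (1 - 2 * b - 1) s * pw (1 + 2 * (a - b) - 1) (1 - s)) := by
      refine le_trans ?_ (setLIntegral_le_lintegral (Ioc (0 : ℝ) 1) _)
      refine setLIntegral_mono (by fun_prop) fun s hs => ?_
      calc _ ≤ pw (-2 * a) s *
            (pw (a - b) s * (ebeta a (1 - b) * pw (a - b) (1 - s))) ^ 2 := by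
            gcongr; exact solAux_le ha hab (by linarith) hs.1
        _ = _ := by
            rw [show 1 - 2 * b - 1 = -2 * a + ((a - b) + (a - b)) by ring,
              show 1 + 2 * (a - b) - 1 = (a - b) + (a - b) by ring, pw_add (-2 * a),
              pw_add (a - b), pw_add (a - b)]
            ring
    refine ne_top_of_le_ne_top ?_ hle
    rw [lintegral_const_mul _ (by fun_prop), lintegral_pw_mul_pw_one (by linarith) (by linarith)]
    finiteness [ebeta_ne_top a (1 - b), ebeta_ne_top (1 - 2 * b) (1 + 2 * (a - b))]
  refine (hint.const_mul ((solConst (a + 1 / 2) (b + 1 / 2) C / Real.Gamma a) ^ 2)).congr ?_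
  refine (ae_restrict_iff' measurableSet_Ioc).2 (Filter.Eventually.of_forall fun s hs => ?_)
  have e : s ^ (-2 * a) = s ^ (-a) * s ^ (-a) := by rw [← Real.rpow_add hs.1]; ring_nf
  simp only [ENNReal.toReal_mul, ENNReal.toReal_pow]
  rw [toReal_pw hs.1, solution_eq hs.1 hs.2, add_sub_cancel_right, add_sub_cancel_right,
    show 1 / 2 - (a + 1 / 2) = -a by ring, e]
  ring

lemma setLIntegral_solAux_mul_covKer (a b u : ℝ) :
    ∫⁻ s in Ioc (0 : ℝ) 1, solAux a b s * covKer a b s u = ∫⁻ s, solAux a b s * covKer a b s u := by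
  rw [← lintegral_indicator measurableSet_Ioc]
  congr 1 with s
  by_cases hs : s ∈ Ioc (0 : ℝ) 1
  · rw [indicator_of_mem hs]
  · rw [indicator_of_notMem hs]
    rcases le_or_gt s 0 with h | h
    · simp [covKer_of_nonpos h]
    · have h2 : 1 ≤ s := by by_contra! h2; exact hs ⟨h, h2.le⟩
      simp [solAux_of_one_le h2]

lemma lintegral_solAux_mul_covKer_ne_top {a b u : ℝ} (ha : 0 < a) (hab : a < b) (hb1 : b < 1 / 2)
    (hu : 0 < u) (hu1 : u ≤ 1) : ∫⁻ s, solAux a b s * covKer a b s u ≠ ∞ := by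
  intro h
  have := lintegral_solAux_mul_covKer ha hab hb1 hu hu1
  rw [h, ENNReal.top_mul (ebeta_ne_zero (by linarith) one_pos)] at this
  refine absurd this.symm ?_
  finiteness [ebeta_ne_top a (1 - a), ebeta_ne_top b (1 - b), ebeta_ne_top (1 - 2 * b) b,
    ebeta_ne_top (1 - a) (1 - a), pw_ne_top (-2 * a) u]

/-- Finiteness off a null set is read off from the finite integral against the strictly positive
`solAux`, with no estimate near the diagonal. -/
lemma ae_covKer_ne_top {a b u : ℝ} (ha : 0 < a) (hab : a < b) (hb1 : b < 1 / 2)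
    (hu : 0 < u) (hu1 : u ≤ 1) : ∀ᵐ s, s ∈ Ioo (0 : ℝ) 1 → covKer a b s u ≠ ∞ := by
  filter_upwards [ae_lt_top (by fun_prop)
    (lintegral_solAux_mul_covKer_ne_top ha hab hb1 hu hu1)] with s hs hs01 htop
  rw [htop, ENNReal.mul_top (solAux_ne_zero hs01.1 hs01.2)] at hs
  exact lt_irrefl _ hs

lemma solution_mul_kernelk₁ {a b C s u : ℝ} (ha : 0 < a) (hab : a < b) (hb1 : b < 1 / 2)
    (hs : s ∈ Ioc (0 : ℝ) 1) (hu : 0 < u) :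
    solution (a + 1 / 2) (b + 1 / 2) C s * kernelk₁ (a + 1 / 2) (b + 1 / 2) s u =
      solConst (a + 1 / 2) (b + 1 / 2) C / Real.Gamma a * (u ^ a * betaH (b + 1 / 2) ^ 2) *
        (solAux a b s * covKer a b s u).toReal := by
  rw [solution_eq hs.1 hs.2, kernelk₁_eq (by linarith) (by linarith) (by linarith) hs.1 hu,
    add_sub_cancel_right, add_sub_cancel_right, show 1 / 2 - (a + 1 / 2) = -a by ring,
    ENNReal.toReal_mul, Real.rpow_neg hs.1.le]
  have := (Real.rpow_pos_of_pos hs.1 a).ne'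
  field_simp

lemma integral_solution_mul_kernelk₁ {a b C u : ℝ} (ha : 0 < a) (hab : a < b) (hb1 : b < 1 / 2)
    (hu : 0 < u) (hu1 : u ≤ 1) :
    IntegrableOn (fun s => solution (a + 1 / 2) (b + 1 / 2) C s *
        kernelk₁ (a + 1 / 2) (b + 1 / 2) s u) (Ioc (0 : ℝ) 1) ∧
      opK (a + 1 / 2) (b + 1 / 2) (solution (a + 1 / 2) (b + 1 / 2) C) u =
        solConst (a + 1 / 2) (b + 1 / 2) C / Real.Gamma a * (u ^ a * betaH (b + 1 / 2) ^ 2) *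
          (∫⁻ s, solAux a b s * covKer a b s u).toReal := by
  have hfin := lintegral_solAux_mul_covKer_ne_top ha hab hb1 hu hu1
  constructor
  · refine IntegrableOn.congr_fun (f := fun s =>
      solConst (a + 1 / 2) (b + 1 / 2) C / Real.Gamma a * (u ^ a * betaH (b + 1 / 2) ^ 2) *
        (solAux a b s * covKer a b s u).toReal) ?_
      (fun s hs => (solution_mul_kernelk₁ ha hab hb1 hs hu).symm) measurableSet_Ioc
    refine Integrable.const_mul (integrable_toReal_of_lintegral_ne_top (by fun_prop) ?_) _
    rwa [setLIntegral_solAux_mul_covKer]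
  · rw [opK, intervalIntegral.integral_of_le zero_le_one,
      setIntegral_congr_fun measurableSet_Ioc
        fun s hs => solution_mul_kernelk₁ ha hab hb1 hs hu,
      integral_const_mul, integral_toReal (by fun_prop)
        (ae_lt_top (by fun_prop) (by rwa [setLIntegral_solAux_mul_covKer])),
      setLIntegral_solAux_mul_covKer]

/-- The constants in the equation cancel. -/
lemma solConst_mul_beta {a b C : ℝ} (ha : 0 < a) (hab : a < b) (hb1 : b < 1 / 2) (hC : 0 < C) :
    C * (solConst (a + 1 / 2) (b + 1 / 2) C / Real.Gamma a * betaH (b + 1 / 2) ^ 2) *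
      (ProbabilityTheory.beta a (1 - a) * ProbabilityTheory.beta b (1 - b) *
        (ProbabilityTheory.beta (1 - 2 * b) b * ProbabilityTheory.beta (1 - a) (1 - a))) =
      ProbabilityTheory.beta (1 - 2 * a) 1 := by
  have hB := ProbabilityTheory.beta_pos (show 0 < b by linarith) (show 0 < 1 - 2 * b by linarith)
  rw [betaH, add_sub_cancel_right, show 2 - 2 * (b + 1 / 2) = 1 - 2 * b by ring,
    Real.sq_sqrt (div_nonneg (mul_nonneg (by linarith) (by linarith)) hB.le), solConst]
  have e : 2 * (b + 1 / 2) - 1 = 2 * b := by ring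
  rw [e]
  simp only [ProbabilityTheory.beta]
  rw [show 2 - 2 * (a + 1 / 2) = 1 - 2 * a by ring, show 3 / 2 - (a + 1 / 2) = 1 - a by ring,
    add_sub_cancel_right, show 3 / 2 - (b + 1 / 2) = 1 - b by ring, show a + (1 - a) = 1 by ring,
    show b + (1 - b) = 1 by ring, show 1 - 2 * b + b = 1 - b by ring,
    show b + (1 - 2 * b) = 1 - b by ring, show 1 - a + (1 - a) = 1 - 2 * a + 1 by ring,
    Real.Gamma_one]
  have g1 := (Real.Gamma_pos_of_pos (show 0 < a by linarith)).ne'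
  have g2 := (Real.Gamma_pos_of_pos (show 0 < b by linarith)).ne'
  have g3 := (Real.Gamma_pos_of_pos (show 0 < 1 - a by linarith)).ne'
  have g4 := (Real.Gamma_pos_of_pos (show 0 < 1 - b by linarith)).ne'
  have g5 := (Real.Gamma_pos_of_pos (show 0 < 1 - 2 * a by linarith)).ne'
  have g6 := (Real.Gamma_pos_of_pos (show 0 < 1 - 2 * b by linarith)).ne'
  have g7 := (Real.Gamma_pos_of_pos (show 0 < 1 - 2 * a + 1 by linarith)).ne'
  have hb0 : b ≠ 0 := by linarith
  have hb2 : b + 1 / 2 ≠ 0 := by linarith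
  -- No functional equation of the Gamma function is needed: `Γ(2 - 2a)` occurs in a beta value on
  -- each side and cancels, so the identity is rational in the Gamma values.
  generalize b + 1 / 2 = H at *
  generalize Real.Gamma a = x1 at *
  generalize Real.Gamma b = x2 at *
  generalize Real.Gamma (1 - a) = x3 at *
  generalize Real.Gamma (1 - b) = x4 at *
  generalize Real.Gamma (1 - 2 * a) = x5 at *
  generalize Real.Gamma (1 - 2 * b) = x6 at *
  generalize Real.Gamma (1 - 2 * a + 1) = x7 at *
  field_simp

lemma solution_solves {a b C u : ℝ} (ha : 0 < a) (hab : a < b) (hb1 : b < 1 / 2) (hC : 0 < C)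
    (hu : 0 < u) (hu1 : u ≤ 1) :
    u ^ (-a) = C * opK (a + 1 / 2) (b + 1 / 2) (solution (a + 1 / 2) (b + 1 / 2) C) u := by
  rw [(integral_solution_mul_kernelk₁ ha hab hb1 hu hu1).2]
  have h := congrArg ENNReal.toReal (lintegral_solAux_mul_covKer ha hab hb1 hu hu1)
  simp only [ENNReal.toReal_mul] at h
  have hB : ∀ {x y : ℝ}, 0 < x → 0 < y → (ebeta x y).toReal = ProbabilityTheory.beta x y :=
    fun hx hy => ENNReal.toReal_ofReal (ProbabilityTheory.beta_pos hx hy).le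
  rw [hB (by linarith) one_pos, hB ha (by linarith), hB (by linarith) (by linarith),
    hB (by linarith) (by linarith), hB (by linarith) (by linarith), toReal_pw hu] at h
  have hc := solConst_mul_beta ha hab hb1 hC
  have hpos := ProbabilityTheory.beta_pos (show 0 < 1 - 2 * a by linarith) one_pos
  refine mul_right_cancel₀ hpos.ne' ?_
  rw [mul_assoc C, mul_assoc (_ * _) _ (ProbabilityTheory.beta _ _), h]
  have e : u ^ (-a) = u ^ a * u ^ (-2 * a) := by rw [← Real.rpow_add hu]; ring_nf
  conv_lhs => rw [← hc]
  rw [e]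
  ring

/-! ### Uniqueness for signed solutions. -/

lemma solution_unique {a b C : ℝ} (ha : 0 < a) (hab : a < b) (hb1 : b < 1 / 2) (hC : 0 < C)
    {h : ℝ → ℝ} (hh : AEStronglyMeasurable h (volume.restrict (Ioc (0 : ℝ) 1)))
    (heq : ∀ᵐ u ∂(volume.restrict (Ioc (0 : ℝ) 1)),
      IntegrableOn (fun s => h s * kernelk₁ (a + 1 / 2) (b + 1 / 2) s u) (Ioc (0 : ℝ) 1) ∧
      u ^ (-a) = C * opK (a + 1 / 2) (b + 1 / 2) h u) :
    h =ᵐ[volume.restrict (Ioc (0 : ℝ) 1)] solution (a + 1 / 2) (b + 1 / 2) C := by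
  have hb : 0 < b := ha.trans hab
  have hsC : 0 < solConst (a + 1 / 2) (b + 1 / 2) C / Real.Gamma a := by
    refine div_pos (div_pos (Real.Gamma_pos_of_pos (by linarith)) ?_) (Real.Gamma_pos_of_pos ha)
    have g2 := Real.Gamma_pos_of_pos (show 0 < b + 1 / 2 - 1 / 2 by linarith)
    have g3 := Real.Gamma_pos_of_pos (show 0 < 3 / 2 - (a + 1 / 2) by linarith)
    have g4 := Real.Gamma_pos_of_pos (show 0 < 3 / 2 - (b + 1 / 2) by linarith)
    have g5 : 0 < 2 * (b + 1 / 2) - 1 := by linarith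
    positivity
  set D := solConst (a + 1 / 2) (b + 1 / 2) C / Real.Gamma a with hD
  have hβ : 0 < betaH (b + 1 / 2) := by
    refine Real.sqrt_pos.2 (div_pos (mul_pos (by linarith) (by linarith))
      (ProbabilityTheory.beta_pos (by linarith) (by linarith)))
  obtain ⟨w, hw, hhw⟩ := hh
  have hw' := hw.measurable
  -- The positive and negative parts of `s^a h`, cut off to `(0,1)`; the goal becomes `pos = neg + D
  -- * solAux`, whose right side is nonnegative since `D > 0`.
  set pos : ℝ → ℝ≥0∞ := (Ioo 0 1).indicator fun s => pw a s * ENNReal.ofReal (w s) with hpos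
  set neg : ℝ → ℝ≥0∞ := (Ioo 0 1).indicator fun s => pw a s * ENNReal.ofReal (-w s) with hneg
  have mpos : Measurable pos := Measurable.indicator (by fun_prop) measurableSet_Ioo
  have mneg : Measurable neg := Measurable.indicator (by fun_prop) measurableSet_Ioo
  have hmain : ∀ᵐ u, 0 < u → u < 1 → ∫⁻ s, pos s * covKer a b s u ≠ ∞ ∧
      ∫⁻ s, pos s * covKer a b s u =
        ∫⁻ s, (neg s + ENNReal.ofReal D * solAux a b s) * covKer a b s u := by
    filter_upwards [(ae_restrict_iff' measurableSet_Ioc).1 heq] with u hu h0 h1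
    obtain ⟨hint, hval⟩ := hu ⟨h0, h1.le⟩
    have hQ : 0 < u ^ a * betaH (b + 1 / 2) ^ 2 := by
      have := Real.rpow_pos_of_pos h0 a
      positivity
    set Q := u ^ a * betaH (b + 1 / 2) ^ 2 with hQdef
    set F : ℝ → ℝ := fun s => h s * kernelk₁ (a + 1 / 2) (b + 1 / 2) s u with hF
    -- The kernel is nonnegative, so the parts of the integrand are the parts of `h` times the
    -- kernel; `e = 1` and `e = -1` give the two parts.
    have hparts : ∀ (e : ℝ), ∫⁻ s in Ioc (0 : ℝ) 1, ENNReal.ofReal (e * F s) =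
        ENNReal.ofReal Q * ∫⁻ s, (Ioo 0 1).indicator
          (fun s => pw a s * ENNReal.ofReal (e * w s)) s * covKer a b s u := by
      intro e
      rw [← restrict_Ioo_eq_restrict_Ioc, ← lintegral_const_mul' _ _ ENNReal.ofReal_ne_top,
        ← lintegral_indicator measurableSet_Ioo]
      refine lintegral_congr_ae ?_
      have hw2 := (ae_restrict_iff' measurableSet_Ioc).1 hhw
      filter_upwards [hw2, ae_covKer_ne_top ha hab hb1 h0 h1.le] with s hs hcov
      by_cases hs01 : s ∈ Ioo (0 : ℝ) 1
      · rw [indicator_of_mem hs01, indicator_of_mem hs01, hF]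
        have hsa := Real.rpow_pos_of_pos hs01.1 a
        simp only
        rw [hs ⟨hs01.1, hs01.2.le⟩,
          kernelk₁_eq (by linarith) (by linarith) (by linarith) hs01.1 h0, add_sub_cancel_right,
          add_sub_cancel_right, ← hQdef, show ∀ p q r m n : ℝ, p * (q * (r * (m * n))) =
            r * (m * (p * q) * n) by intros; ring, ENNReal.ofReal_mul hQ.le,
          ENNReal.ofReal_mul' ENNReal.toReal_nonneg, ENNReal.ofReal_toReal (hcov hs01),
          ENNReal.ofReal_mul hsa.le, pw_of_pos hs01.1]
      · simp [indicator_of_notMem hs01]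
    have hFpos := hparts 1
    have hFneg := hparts (-1)
    simp only [one_mul, neg_one_mul] at hFpos hFneg
    have hQ0 : ENNReal.ofReal Q ≠ 0 := by simpa using hQ
    have fpos : ENNReal.ofReal Q * ∫⁻ s, pos s * covKer a b s u ≠ ∞ := by
      rw [← hFpos]; exact hint.lintegral_lt_top.ne
    have fneg : ENNReal.ofReal Q * ∫⁻ s, neg s * covKer a b s u ≠ ∞ := by
      rw [← hFneg]; exact hint.neg.lintegral_lt_top.ne
    have fsol := lintegral_solAux_mul_covKer_ne_top ha hab hb1 h0 h1.le
    have hposfin : ∫⁻ s, pos s * covKer a b s u ≠ ∞ := fun htop =>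
      fpos (by rw [htop, ENNReal.mul_top hQ0])
    have hnegfin : ∫⁻ s, neg s * covKer a b s u ≠ ∞ := fun htop =>
      fneg (by rw [htop, ENNReal.mul_top hQ0])
    refine ⟨hposfin, ?_⟩
    -- As the explicit function solves the equation too, both images agree at `u`; finiteness of all
    -- three integrals lets the real identity be rewritten without subtraction in `ℝ≥0∞`.
    have hop : opK (a + 1 / 2) (b + 1 / 2) h u =
        opK (a + 1 / 2) (b + 1 / 2) (solution (a + 1 / 2) (b + 1 / 2) C) u :=
      mul_left_cancel₀ hC.ne' (hval.symm.trans (solution_solves ha hab hb1 hC h0 h1.le))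
    rw [(integral_solution_mul_kernelk₁ ha hab hb1 h0 h1.le).2, opK,
      intervalIntegral.integral_of_le zero_le_one,
      integral_eq_lintegral_pos_part_sub_lintegral_neg_part hint, hFpos, hFneg,
      ENNReal.toReal_mul, ENNReal.toReal_mul, ENNReal.toReal_ofReal hQ.le, ← hD, ← hQdef] at hop
    have hop' : (∫⁻ s, pos s * covKer a b s u).toReal = (∫⁻ s, neg s * covKer a b s u).toReal +
        D * (∫⁻ s, solAux a b s * covKer a b s u).toReal := by
      refine mul_left_cancel₀ hQ.ne' ?_
      linarith
    simp_rw [add_mul, mul_assoc]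
    rw [lintegral_add_left (by fun_prop), lintegral_const_mul' _ _ ENNReal.ofReal_ne_top,
      ← ENNReal.toReal_eq_toReal_iff' hposfin
        (ENNReal.add_ne_top.2 ⟨hnegfin, ENNReal.mul_ne_top ENNReal.ofReal_ne_top fsol⟩), hop',
      ENNReal.toReal_add hnegfin (ENNReal.mul_ne_top ENNReal.ofReal_ne_top fsol),
      ENNReal.toReal_mul, ENNReal.toReal_ofReal hsC.le]
  have hsplit := ae_eq_of_lintegral_covKer_eq ha (by linarith) hab (by linarith) mpos
    (g := fun s => neg s + ENNReal.ofReal D * solAux a b s) (by fun_prop)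
    (fun s hs => indicator_of_notMem (fun hs' => hs.not_gt hs'.2) _)
    (fun s hs => by
      rw [solAux_of_one_le hs, mul_zero, add_zero]
      exact indicator_of_notMem (fun hs' => hs.not_gt hs'.2) _)
    (hmain.mono fun u hu h0 h1 => (hu h0 h1).1) (hmain.mono fun u hu h0 h1 => (hu h0 h1).2)
  refine hhw.trans ?_
  rw [← restrict_Ioo_eq_restrict_Ioc]
  refine (ae_restrict_iff' measurableSet_Ioo).2 ?_
  filter_upwards [hsplit] with s hs hs01
  have h1 := hs hs01.1
  have fsol := solAux_ne_top ha hab (show b < 1 by linarith) hs01.1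
  have h2 := congrArg ENNReal.toReal h1
  rw [hpos, hneg, indicator_of_mem hs01, indicator_of_mem hs01, ENNReal.toReal_add
    (ENNReal.mul_ne_top (pw_ne_top _ _) ENNReal.ofReal_ne_top)
    (ENNReal.mul_ne_top ENNReal.ofReal_ne_top fsol), ENNReal.toReal_mul, ENNReal.toReal_mul,
    ENNReal.toReal_mul, toReal_pw hs01.1, ENNReal.toReal_ofReal hsC.le, ENNReal.toReal_ofReal',
    ENNReal.toReal_ofReal'] at h2
  rw [solution_eq hs01.1 hs01.2.le, add_sub_cancel_right, add_sub_cancel_right,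
    show 1 / 2 - (a + 1 / 2) = -a by ring, Real.rpow_neg hs01.1.le, ← hD]
  have hsa := (Real.rpow_pos_of_pos hs01.1 a).ne'
  have hmax : max (w s) 0 - max (-w s) 0 = w s := max_zero_sub_eq_self (w s)
  rw [← hmax]
  field_simp
  linarith

end MixedFBM

theorem lemma3p1 (H₁ H₂ : ℝ) (hH₁ : 1 / 2 < H₁) (hH₁₂ : H₁ < H₂) (hH₂ : H₂ < 1)
    (C : ℝ) (hC : 0 < C) :
    -- the explicit function lies in `L²` and solves the equation at every point of `(0,1]`
    (MemLp (MixedFBM.solution H₁ H₂ C) 2 (volume.restrict (Ioc (0 : ℝ) 1)) ∧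
      ∀ u ∈ Ioc (0 : ℝ) 1,
        IntegrableOn (fun s => MixedFBM.solution H₁ H₂ C s * MixedFBM.kernelk₁ H₁ H₂ s u)
          (Ioc (0 : ℝ) 1) ∧
        u ^ (1 / 2 - H₁) = C * MixedFBM.opK H₁ H₂ (MixedFBM.solution H₁ H₂ C) u) ∧
    -- every measurable solution, even of the equation for almost every `u`, agrees with it
    ∀ h : ℝ → ℝ, AEStronglyMeasurable h (volume.restrict (Ioc (0 : ℝ) 1)) →
      (∀ᵐ u ∂(volume.restrict (Ioc (0 : ℝ) 1)),
        IntegrableOn (fun s => h s * MixedFBM.kernelk₁ H₁ H₂ s u) (Ioc (0 : ℝ) 1) ∧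
        u ^ (1 / 2 - H₁) = C * MixedFBM.opK H₁ H₂ h u) →
      h =ᵐ[volume.restrict (Ioc (0 : ℝ) 1)] MixedFBM.solution H₁ H₂ C := by
  refine ⟨⟨MixedFBM.memLp_solution hH₁ hH₁₂ hH₂ C, ?_⟩, ?_⟩
  all_goals
    obtain ⟨a, rfl⟩ : ∃ a, H₁ = a + 1 / 2 := ⟨H₁ - 1 / 2, by ring⟩
    obtain ⟨b, rfl⟩ : ∃ b, H₂ = b + 1 / 2 := ⟨H₂ - 1 / 2, by ring⟩
    rw [show 1 / 2 - (a + 1 / 2) = -a by ring]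
  · exact fun u hu => ⟨(MixedFBM.integral_solution_mul_kernelk₁ (by linarith) (by linarith)
      (by linarith) hu.1 hu.2).1, MixedFBM.solution_solves (by linarith) (by linarith)
      (by linarith) hC hu.1 hu.2⟩
  · exact fun h hh heq => MixedFBM.solution_unique (by linarith) (by linarith) (by linarith) hC
      hh heq
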